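/- **Model.** Let $\mathsf X=[\ell,u]\subseteq\mathbb R$ be a closed interval with $-\infty\le\ell<u\le\infty$ (infinite end points are not points of $\mathsf X$), and let $\beta\in[0,1)$. A project has state $X_t\in\mathsf X$ and action $A_t\in\{0,1\}$ in period $t=0,1,\dots$; in state $x$ under action $a$ it yields reward $r(x,a)$, consumes $c(x,a)$ resource units, and moves to a next state with law $\kappa^a(x,\cdot)$, where $\kappa^0,\kappa^1$ are Markov kernels on $\mathsf X$. Assume that $r(\cdot,a),c(\cdot,a)$ are continuous, $0\le c(x,0)<c(x,1)$, and that there are a measurable $w:\mathsf X\to[1,\infty)$ and constants $M>0$, $\rho\in[\beta,1)$ such that, for all $x$ and $a$, $\max\{|r(x,a)|,c(x,a)\}\le M\,w(x)$, $\int w\,d\kappa^a(x,\cdot)<\infty$ and $\beta\int w(y)\,\kappa^a(x,dy)\le\rho\,w(x)$. Let $\Pi$ be the class of history-dependent randomized policies. For $\pi\in\Pi$ and a probability measure $p$ on $\mathsf X$ with $\int w\,dp<\infty$, put $$F(p,\pi)=\mathsf E_p^\pi\Big[\sum_{t\ge0}\beta^t r(X_t,A_t)\Big],\qquad G(p,\pi)=\mathsf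 E_p^\pi\Big[\sum_{t\ge0}\beta^t c(X_t,A_t)\Big],\qquad X_0\sim p,$$ and write $F(x,\pi),G(x,\pi)$ when $p=\delta_x$. For a threshold $z\in[-\infty,\infty]$, the $z$-policy takes action $1$ exactly in the states $x>z$, and the $z^-$-policy takes action $1$ exactly in the states $x\ge z$; their metrics are written $F(p,z),G(p,z)$ and $F(p,z^-),G(p,z^-)$. Let $\langle a,\pi\rangle$ be the policy that takes action $a$ at time $0$ and follows $\pi$ from time $1$ on. Put $$f(x,z)=F(x,\langle1,z\rangle)-F(x,\langle0,z\rangle),\qquad g(x,z)=G(x,\langle1,z\rangle)-G(x,\langle0,z\rangle).$$ The marginal productivity (MP) index is $m^*(x)=f(x,x)/g(x,x)$ for $x\in\mathsf X$; it is extended to $\mathbb R$ by $m^*(z)=m^*(\ell)$ for $z<\ell$ and $m^*(z)=m^*(u)$ for $z>u$, and to $z=\pm\infty$ by its limits. The project is *PCL-indexable* if (i) $g(x,z)>0$ for all $x\in\mathsf X$ and $z\in[-\infty,\infty]$; (ii) $m^*$ is nondecreasing, continuous and bounded below on $\mathsf X$; (iii) for every $x\in\mathsf X$ and all real $z_1<z_2$,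 $$F(x,z_2)-F(x,z_1)=\int_{(z_1,z_2]}m^*(z)\,G(x,dz)\quad\text{(Lebesgue–Stieltjes integral)}.$$ Let $\mathsf R_G(p)=\{G(p,\pi):\pi\in\Pi\}$ and, for $\gamma\in\mathsf R_G(p)$, let $\Phi_p(\gamma)=\sup\{F(p,\pi):\pi\in\Pi,\ G(p,\pi)=\gamma\}$. **Proposition (MP index as shadow price).** Let the project be PCL-indexable and let $p$ be a probability measure on $\mathsf X$ with $\int w\,dp<\infty$ whose support is all of $\mathsf X$. Then $\Phi_p$ is differentiable on the interior of $\mathsf R_G(p)$, and for every $\gamma$ in this interior and every $z\in[-\infty,\infty]$, $$\Phi_p'(\gamma)=m^*(z)\quad\text{whenever } G(p,z)\le\gamma\le G(p,z^-).$$ -/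

import Mathlib

open MeasureTheory ProbabilityTheory Filter Topology Set

noncomputable section

/-- The closed interval `[ℓ, u]` of real numbers with possibly infinite end points. -/
def stateInterval (ℓ u : EReal) : Set ℝ := {x : ℝ | ℓ ≤ (x : EReal) ∧ (x : EReal) ≤ u}

/-- The Lebesgue–Stieltjes integral `∫_s J dα` with respect to a (right-continuous) function `α` of
bounded variation on the real line; the signed measure gives mass `α b - α a` to `(a, b]`. -/
def lsIntegral (s : Set ℝ) (J α : ℝ → ℝ) : ℝ :=
  open scoped Classical in
  if h : BoundedVariationOn α Set.univ then ∫ᵛ t in s, J t ∂<•h.vectorMeasure else 0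

/-- A discounted discrete time restless bandit project with state space `[ℓ, u]`. Actions are
Booleans: `true` is the active action `1`, `false` the passive action `0`. -/
structure Project where
  /-- left end point of the state space -/
  ℓ : EReal
  /-- right end point of the state space -/
  u : EReal
  ℓ_lt_u : ℓ < u
  /-- discount factor -/
  β : ℝ
  β_nonneg : 0 ≤ β
  β_lt_one : β < 1
  /-- one-period reward -/
  r : stateInterval ℓ u → Bool → ℝ
  /-- one-period resource consumption -/
  c : stateInterval ℓ u → Bool → ℝ
  /-- transition law: `κ (x, a)` is the law of the next state given state `x` and action `a` -/
  κ : Kernel (stateInterval ℓ u × Bool) (stateInterval ℓ u)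
  κ_markov : IsMarkovKernel κ
  /-- weight function -/
  w : stateInterval ℓ u → ℝ
  r_continuous : ∀ a, Continuous fun x => r x a
  c_continuous : ∀ a, Continuous fun x => c x a
  c_passive_nonneg : ∀ x, 0 ≤ c x false
  c_passive_lt_active : ∀ x, c x false < c x true
  w_measurable : Measurable w
  one_le_w : ∀ x, 1 ≤ w x
  w_integrable : ∀ x a, Integrable w (κ (x, a))
  w_bounds : ∃ M > 0, ∃ γ : ℝ, β ≤ γ ∧ γ < 1 ∧ ∀ x a,
    max |r x a| (c x a) ≤ M * w x ∧ β * ∫ y, w y ∂(κ (x, a)) ≤ γ * w x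

/-- A history-dependent randomized control policy: `init` is the law of the action at time `0` given
`X_0`, and `step n` is the law of the action at time `n + 1` given the states and actions at the
times `0, …, n` and the state `X_{n + 1}`. -/
structure Policy (X : Type*) [MeasurableSpace X] where
  /-- randomized decision at time `0` -/
  init : Kernel X Bool
  /-- randomized decision at time `n + 1` -/
  step : (n : ℕ) → Kernel ((Finset.Iic n → X × Bool) × X) Bool
  init_markov : IsMarkovKernel init
  step_markov : ∀ n, IsMarkovKernel (step n)

attribute [instance] Project.κ_markov Policy.init_markov Policy.step_markov

namespace Policy

variable {X : Type*} [MeasurableSpace X]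

open scoped Classical in
/-- The action prescribed in a state by the active region `B`. -/
def regionAction (B : Set X) (x : X) : Bool := decide (x ∈ B)

theorem measurable_regionAction {B : Set X} (hB : MeasurableSet B) :
    Measurable (regionAction B) := by
  refine measurable_to_bool ?_
  have h : regionAction B ⁻¹' {true} = B := by ext x; simp [regionAction]
  rw [h]; exact hB

/-- The stationary deterministic policy with active region `B`. -/
def ofRegion (B : Set X) (hB : MeasurableSet B) : Policy X where
  init := Kernel.deterministic (regionAction B) (measurable_regionAction hB)
  step _ := Kernel.deterministic (fun h => regionAction B h.2)
    ((measurable_regionAction hB).comp measurable_snd)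
  init_markov := inferInstance
  step_markov _ := inferInstance

/-- The history seen from time `1` on. -/
def shiftHistory (n : ℕ) (h : (Finset.Iic (n + 1) → X × Bool) × X) :
    (Finset.Iic n → X × Bool) × X :=
  (fun i => h.1 ⟨i.1 + 1, Finset.mem_Iic.2 (Nat.succ_le_succ (Finset.mem_Iic.1 i.2))⟩, h.2)

theorem measurable_shiftHistory (n : ℕ) :
    Measurable (shiftHistory n : (Finset.Iic (n + 1) → X × Bool) × X → _) := by
  unfold shiftHistory
  fun_prop

/-- The decisions at times `n + 1` of the policy `⟨a, π⟩`. -/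
def prependStep (π : Policy X) : (n : ℕ) → Kernel ((Finset.Iic n → X × Bool) × X) Bool
  | 0 => π.init.comap Prod.snd measurable_snd
  | n + 1 => (π.step n).comap (shiftHistory n) (measurable_shiftHistory n)

/-- The policy `⟨a, π⟩` that takes action `a` at time `0` and follows `π` from time `1` on. -/
def prepend (a : Bool) (π : Policy X) : Policy X where
  init := Kernel.const X (Measure.dirac a)
  step := π.prependStep
  init_markov := inferInstance
  step_markov n := by cases n <;> (unfold prependStep; infer_instance)

end Policy

namespace Project

variable (P : Project)

/-- The state space `𝖷 = [ℓ, u]`. -/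
abbrev State : Type := stateInterval P.ℓ P.u

/-- The law of `(X_{n+1}, A_{n+1})` given the states and actions at times `0, …, n`. -/
def stepKernel (π : Policy P.State) (n : ℕ) :
    Kernel (Finset.Iic n → P.State × Bool) (P.State × Bool) :=
  P.κ.comap (fun h => h ⟨n, Finset.mem_Iic.2 le_rfl⟩) (measurable_pi_apply _) ⊗ₖ π.step n

instance (π : Policy P.State) (n : ℕ) : IsMarkovKernel (P.stepKernel π n) := by
  unfold stepKernel; infer_instance

/-- The law `𝖯_p^π` of the path of states and actions under the policy `π` when `X_0 ∼ p`. -/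
def pathLaw (p : Measure P.State) (π : Policy P.State) : Measure (ℕ → P.State × Bool) :=
  Kernel.trajMeasure (X := fun _ => P.State × Bool) (p ⊗ₘ π.init) (P.stepKernel π)

/-- The reward performance metric `F(p, π)`. -/
def F (p : Measure P.State) (π : Policy P.State) : ℝ :=
  ∫ ω, ∑' t : ℕ, P.β ^ t * P.r (ω t).1 (ω t).2 ∂(P.pathLaw p π)

/-- The resource performance metric `G(p, π)`. -/
def G (p : Measure P.State) (π : Policy P.State) : ℝ :=
  ∫ ω, ∑' t : ℕ, P.β ^ t * P.c (ω t).1 (ω t).2 ∂(P.pathLaw p π)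

/-- The `z`-policy: active in state `x` if and only if `x > z`. -/
def threshold (z : EReal) : Policy P.State :=
  Policy.ofRegion {x | z < ((x : ℝ) : EReal)}
    (measurableSet_lt measurable_const (measurable_coe_real_ereal.comp measurable_subtype_coe))

/-- The `z⁻`-policy: active in state `x` if and only if `x ≥ z`. -/
def thresholdLeft (z : EReal) : Policy P.State :=
  Policy.ofRegion {x | z ≤ ((x : ℝ) : EReal)}
    (measurableSet_le measurable_const (measurable_coe_real_ereal.comp measurable_subtype_coe))

/-- The marginal reward metric `f(x, π) = F(x, ⟨1, π⟩) - F(x, ⟨0, π⟩)`. -/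
def f (x : P.State) (π : Policy P.State) : ℝ :=
  P.F (Measure.dirac x) (π.prepend true) - P.F (Measure.dirac x) (π.prepend false)

/-- The marginal resource metric `g(x, π) = G(x, ⟨1, π⟩) - G(x, ⟨0, π⟩)`. -/
def g (x : P.State) (π : Policy P.State) : ℝ :=
  P.G (Measure.dirac x) (π.prepend true) - P.G (Measure.dirac x) (π.prepend false)

/-- The marginal productivity index `m*(x) = f(x, x) / g(x, x)` of a state `x`. -/
def mpIndex (x : P.State) : ℝ :=
  P.f x (P.threshold ((x : ℝ) : EReal)) / P.g x (P.threshold ((x : ℝ) : EReal))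

theorem coe_clamp (z : ℝ) :
    (((max P.ℓ (min (z : EReal) P.u)).toReal : ℝ) : EReal) = max P.ℓ (min (z : EReal) P.u) := by
  have hl := P.ℓ_lt_u
  apply EReal.coe_toReal
  · exact (max_lt (hl.trans_le le_top) ((min_le_left _ _).trans_lt (EReal.coe_lt_top z))).ne
  · have h : ⊥ < min (z : EReal) P.u := lt_min (EReal.bot_lt_coe z) (bot_le.trans_lt hl)
    exact (h.trans_le (le_max_right _ _)).ne'

/-- The state closest to the real number `z`. -/
def clamp (z : ℝ) : P.State :=
  ⟨(max P.ℓ (min (z : EReal) P.u)).toReal, by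
    have h := P.coe_clamp z
    refine ⟨?_, ?_⟩ <;> rw [h]
    · exact le_max_left _ _
    · exact max_le P.ℓ_lt_u.le (min_le_right _ _)⟩

/-- The extension of `m*` to the real line, constant on `(-∞, ℓ]` and on `[u, ∞)`. -/
def mpIndexReal (z : ℝ) : ℝ := P.mpIndex (P.clamp z)

/-- The extension of `m*` to all thresholds, by its limits at `-∞` and at `∞`. -/
def mpIndexExt (z : EReal) : EReal :=
  if z = ⊥ then limUnder atBot fun x : ℝ => (P.mpIndexReal x : EReal)
  else if z = ⊤ then limUnder atTop fun x : ℝ => (P.mpIndexReal x : EReal)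
  else (P.mpIndexReal z.toReal : EReal)

/-- PCL-indexability (with respect to threshold policies). -/
structure PCLIndexable : Prop where
  marginal_resource_pos : ∀ (x : P.State) (z : EReal), 0 < P.g x (P.threshold z)
  index_monotone : Monotone P.mpIndex
  index_continuous : Continuous P.mpIndex
  index_bddBelow : BddBelow (Set.range P.mpIndex)
  reward_eq_integral : ∀ (x : P.State) (z₁ z₂ : ℝ), z₁ < z₂ →
    P.F (Measure.dirac x) (P.threshold z₂) - P.F (Measure.dirac x) (P.threshold z₁) =
      lsIntegral (Set.Ioc z₁ z₂) P.mpIndexReal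
        (fun z : ℝ => P.G (Measure.dirac x) (P.threshold z))

/-- The achievable resource performance region `{G(p, π) : π ∈ Π}`. -/
def resourceRegion (p : Measure P.State) : Set ℝ := Set.range (P.G p)

/-- The optimal value `Φ_p(γ)` of the problem: maximize `F(p, π)` subject to `G(p, π) = γ`. -/
def Φ (p : Measure P.State) (γ : ℝ) : ℝ := sSup (P.F p '' {π | P.G p π = γ})

end Project

end

/-! The argument is Lagrangian duality, with m*(z) as the multiplier for which the z-policy is
optimal. For each real z, every policy π satisfies F(p,π) − F(p,z) ≤ m*(z) (G(p,π) − G(p,z))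
(`PCLIndexable.F_sub_le`), so the graph of Φ_p lies below a line of slope m*(z). Policies that
differ from the z-policy only by randomizing in the state z give equality
(`PCLIndexable.F_randomized_sub_eq`), and their resource values fill [G(p,z), G(p,z⁻)]. Hence m*(z)
is a supergradient of Φ_p at every γ in that bracket (`Φ_le_Φ_add`), and the brackets cover the
interior of the region. Since p has full support, G(p,·) is strictly decreasing across states, so γ'
close to γ has its bracket at some z' close to z. The supergradient inequalities at γ and γ' squeeze
the increment of Φ_p between m*(z')(γ' − γ) and m*(z)(γ' − γ), and continuity of m* yields the
derivative (`hasDerivAt_Φ`).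

The inequality for π rests on two facts. The performance difference formula
(`value_sub_value_randomized`) writes the gap between two policies as an integral of marginal values
against the discounted occupation measure of one of them. This reduces the claim to the sign of
f(x,z) − m*(z) g(x,z): nonnegative for z < x, nonpositive for z ≥ x. The expression vanishes at z =
x by definition of m*, and it is antitone in z: condition (iii) bounds its increments by products of
an increment of m* and an increment of a resource metric, and such products sum to zero under
refinement because m* is continuous (`antitone_of_sub_le_mul`). -/

noncomputable section

/-! ### Laws of the state-action pair at a fixed time -/

namespace Project

variable (P : Project)

/-- The law of the state and action at time `t`. -/
def stateActionLaw (p : Measure P.State) (π : Policy P.State) (t : ℕ) :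
    Measure (P.State × Bool) :=
  (P.pathLaw p π).map (fun ω => ω t)

instance (p : Measure P.State) [IsProbabilityMeasure p] (π : Policy P.State) :
    IsProbabilityMeasure (P.pathLaw p π) := by
  unfold pathLaw; infer_instance

instance (p : Measure P.State) [IsProbabilityMeasure p] (π : Policy P.State) (t : ℕ) :
    IsProbabilityMeasure (P.stateActionLaw p π t) :=
  Measure.isProbabilityMeasure_map (measurable_pi_apply t).aemeasurable

variable {P} (p : Measure P.State) [IsProbabilityMeasure p] (π : Policy P.State)

omit [IsProbabilityMeasure p] in
theorem stateActionLaw_zero : P.stateActionLaw p π 0 = p ⊗ₘ π.init := by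
  have h : (fun ω : ℕ → P.State × Bool => ω 0) =
      (fun h : (i : Finset.Iic 0) → P.State × Bool => h ⟨0, Finset.mem_Iic.2 le_rfl⟩) ∘
        Preorder.frestrictLe (π := fun _ => P.State × Bool) 0 := rfl
  rw [stateActionLaw, pathLaw, Kernel.trajMeasure, h,
    ← Measure.map_map (by fun_prop) (by fun_prop), Measure.map_comp _ _ (by fun_prop),
    Kernel.traj_map_frestrictLe, Kernel.partialTraj_self]
  erw [Measure.id_comp]
  rw [Measure.map_map (by fun_prop) (by fun_prop)]
  have h' : (fun h : (i : Finset.Iic 0) → P.State × Bool => h ⟨0, Finset.mem_Iic.2 le_rfl⟩) ∘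
      (MeasurableEquiv.piUnique fun _ : Finset.Iic 0 => P.State × Bool).symm = id := by
    ext1 y
    exact (MeasurableEquiv.piUnique fun _ : Finset.Iic 0 => P.State × Bool).apply_symm_apply y
  erw [h', Measure.map_id]

/-- One step of the Ionescu-Tulcea construction: the history up to t, then the transition, then the
decision. Working with `lintegral` avoids integrability conditions. -/
theorem lintegral_stateActionLaw_succ (t : ℕ) {ψ : P.State × Bool → ENNReal}
    (hψ : Measurable ψ) :
    ∫⁻ y, ψ y ∂(P.stateActionLaw p π (t + 1)) =
      ∫⁻ h, ∫⁻ x, ∫⁻ a, ψ (x, a) ∂(π.step t (h, x))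
        ∂(P.κ (h ⟨t, Finset.mem_Iic.2 le_rfl⟩))
        ∂((P.pathLaw p π).map (Preorder.frestrictLe (π := fun _ => P.State × Bool) t)) := by
  have key := Kernel.map_frestrictLe_trajMeasure_compProd_eq_map_trajMeasure
    (X := fun _ => P.State × Bool) (μ₀ := p ⊗ₘ π.init) (κ := P.stepKernel π) (a := t)
  have h1 : P.stateActionLaw p π (t + 1) =
      ((P.pathLaw p π).map (Preorder.frestrictLe (π := fun _ => P.State × Bool) t) ⊗ₘ
        P.stepKernel π t).map Prod.snd := by
    rw [pathLaw, key, Measure.map_map (by fun_prop) (by fun_prop)]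
    rfl
  rw [h1, lintegral_map hψ measurable_snd,
    Measure.lintegral_compProd (by fun_prop)]
  refine lintegral_congr fun h => ?_
  rw [stepKernel, Kernel.lintegral_compProd _ _ _ hψ]
  rfl

omit [IsProbabilityMeasure p] in
theorem lintegral_comp_eval_last (t : ℕ) {ψ : P.State × Bool → ENNReal} (hψ : Measurable ψ) :
    ∫⁻ h : Finset.Iic t → P.State × Bool, ψ (h ⟨t, Finset.mem_Iic.2 le_rfl⟩)
        ∂((P.pathLaw p π).map (Preorder.frestrictLe (π := fun _ => P.State × Bool) t)) =
      ∫⁻ y, ψ y ∂(P.stateActionLaw p π t) := by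
  rw [stateActionLaw, lintegral_map hψ (by fun_prop), lintegral_map (by fun_prop) (by fun_prop)]
  rfl

theorem fst_stateActionLaw_succ (t : ℕ) :
    (P.stateActionLaw p π (t + 1)).fst = P.κ ∘ₘ P.stateActionLaw p π t := by
  refine Measure.ext_of_lintegral _ fun ψ hψ => ?_
  rw [Measure.fst, lintegral_map hψ measurable_fst,
    lintegral_stateActionLaw_succ p π t (ψ := fun y => ψ y.1) (hψ.comp measurable_fst),
    Measure.lintegral_bind (by fun_prop) hψ.aemeasurable,
    ← lintegral_comp_eval_last p π t (Measurable.lintegral_kernel hψ)]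
  simp only [lintegral_const, measure_univ, mul_one]

/-- Only the decision at time t + 1 has to ignore the past, so this also covers ⟨a, π⟩ with π
stationary. -/
theorem stateActionLaw_succ_eq_compProd (t : ℕ) (s : Kernel P.State Bool) [IsMarkovKernel s]
    (hs : π.step t = s.comap Prod.snd measurable_snd) :
    P.stateActionLaw p π (t + 1) = (P.stateActionLaw p π (t + 1)).fst ⊗ₘ s := by
  refine Measure.ext_of_lintegral _ fun ψ hψ => ?_
  have hm : Measurable fun x => ∫⁻ a, ψ (x, a) ∂(s x) := hψ.lintegral_kernel_prod_right'
  rw [Measure.lintegral_compProd hψ, Measure.fst, lintegral_map hm measurable_fst,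
    lintegral_stateActionLaw_succ p π t hψ,
    lintegral_stateActionLaw_succ p π t (ψ := fun y => ∫⁻ a, ψ (y.1, a) ∂(s y.1))
      (hm.comp measurable_fst)]
  simp only [hs, Kernel.comap_apply, lintegral_const, measure_univ, mul_one]

end Project

/-! ### Discounted occupation measures and weighted bounds -/

namespace Project

variable (P : Project)

/-- A contraction factor of the weighted supremum norm. -/
def rate : ℝ := P.w_bounds.choose_spec.2.choose

/-- A weighted bound of the one-period reward and resource consumption. -/
def bound : ℝ := P.w_bounds.choose

theorem β_le_rate : P.β ≤ P.rate := P.w_bounds.choose_spec.2.choose_spec.1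

theorem rate_lt_one : P.rate < 1 := P.w_bounds.choose_spec.2.choose_spec.2.1

theorem rate_nonneg : 0 ≤ P.rate := P.β_nonneg.trans P.β_le_rate

theorem max_le_bound (x : P.State) (a : Bool) : max |P.r x a| (P.c x a) ≤ P.bound * P.w x :=
  (P.w_bounds.choose_spec.2.choose_spec.2.2 x a).1

theorem β_mul_integral_w_le (y : P.State × Bool) :
    P.β * ∫ x, P.w x ∂(P.κ y) ≤ P.rate * P.w y.1 :=
  (P.w_bounds.choose_spec.2.choose_spec.2.2 y.1 y.2).2

theorem w_pos (x : P.State) : 0 < P.w x := one_pos.trans_le (P.one_le_w x)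

theorem ofReal_β_mul_lintegral_w_le (y : P.State × Bool) :
    ENNReal.ofReal P.β * ∫⁻ x, ENNReal.ofReal (P.w x) ∂(P.κ y) ≤
      ENNReal.ofReal P.rate * ENNReal.ofReal (P.w y.1) := by
  rw [← ofReal_integral_eq_lintegral_ofReal (P.w_integrable y.1 y.2)
    (ae_of_all _ fun x => (P.w_pos x).le), ← ENNReal.ofReal_mul P.β_nonneg,
    ← ENNReal.ofReal_mul P.rate_nonneg]
  exact ENNReal.ofReal_le_ofReal (P.β_mul_integral_w_le y)

theorem measurable_ofReal_w : Measurable fun x => ENNReal.ofReal (P.w x) :=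
  P.w_measurable.ennreal_ofReal

/-- The expected total discounted value of a one-period payoff `φ`. -/
def value (φ : P.State × Bool → ℝ) (p : Measure P.State) (π : Policy P.State) : ℝ :=
  ∫ ω, ∑' t : ℕ, P.β ^ t * φ (ω t) ∂(P.pathLaw p π)

/-- The discounted state-action occupation measure. -/
def occupation (p : Measure P.State) (π : Policy P.State) : Measure (P.State × Bool) :=
  Measure.sum fun t => ENNReal.ofReal (P.β ^ t) • P.stateActionLaw p π t

variable {P} (p : Measure P.State) [IsProbabilityMeasure p] (π : Policy P.State)

theorem fst_stateActionLaw_zero : (P.stateActionLaw p π 0).fst = p := by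
  rw [stateActionLaw_zero, Measure.fst_compProd]

/-- The drift condition on w, iterated, gives geometric decay; summing over t makes w integrable for
the occupation measure. -/
theorem ofReal_mul_lintegral_w_stateActionLaw_le (t : ℕ) :
    ENNReal.ofReal (P.β ^ t) * ∫⁻ y, ENNReal.ofReal (P.w y.1) ∂(P.stateActionLaw p π t) ≤
      ENNReal.ofReal P.rate ^ t * ∫⁻ x, ENNReal.ofReal (P.w x) ∂p := by
  have hW := P.measurable_ofReal_w
  induction t with
  | zero =>
    conv_rhs => rw [← fst_stateActionLaw_zero p π, Measure.fst, lintegral_map hW measurable_fst]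
    simp
  | succ t ih =>
    have h1 : ∫⁻ y, ENNReal.ofReal (P.w y.1) ∂(P.stateActionLaw p π (t + 1)) =
        ∫⁻ y, ∫⁻ x, ENNReal.ofReal (P.w x) ∂(P.κ y) ∂(P.stateActionLaw p π t) := by
      rw [← Measure.lintegral_bind (by fun_prop) hW.aemeasurable, ← fst_stateActionLaw_succ,
        Measure.fst, lintegral_map hW measurable_fst]
    rw [h1, pow_succ, ENNReal.ofReal_mul (pow_nonneg P.β_nonneg t), mul_assoc,
      ← lintegral_const_mul _ hW.lintegral_kernel]
    calc _ ≤ ENNReal.ofReal (P.β ^ t) * ∫⁻ y, ENNReal.ofReal P.rate * ENNReal.ofReal (P.w y.1)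
          ∂(P.stateActionLaw p π t) := by
          refine mul_le_mul_right (lintegral_mono fun y => ?_) _
          exact P.ofReal_β_mul_lintegral_w_le y
      _ = ENNReal.ofReal P.rate * (ENNReal.ofReal (P.β ^ t) *
            ∫⁻ y, ENNReal.ofReal (P.w y.1) ∂(P.stateActionLaw p π t)) := by
          rw [lintegral_const_mul' _ _ ENNReal.ofReal_ne_top, mul_left_comm]
      _ ≤ _ := by
          rw [pow_succ', mul_assoc]
          gcongr

omit [IsProbabilityMeasure p] in
theorem lintegral_occupation (ψ : P.State × Bool → ENNReal) :
    ∫⁻ y, ψ y ∂(P.occupation p π) =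
      ∑' t, ENNReal.ofReal (P.β ^ t) * ∫⁻ y, ψ y ∂(P.stateActionLaw p π t) := by
  simp [occupation, lintegral_sum_measure]

theorem lintegral_w_occupation_lt_top (hw : Integrable P.w p) :
    ∫⁻ y, ENNReal.ofReal (P.w y.1) ∂(P.occupation p π) < ⊤ := by
  rw [lintegral_occupation]
  refine (ENNReal.tsum_le_tsum (ofReal_mul_lintegral_w_stateActionLaw_le p π)).trans_lt ?_
  rw [ENNReal.tsum_mul_right, ENNReal.tsum_geometric]
  refine ENNReal.mul_lt_top ?_ ?_
  · rw [ENNReal.inv_lt_top]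
    simpa using P.rate_lt_one
  · rw [← ofReal_integral_eq_lintegral_ofReal hw (ae_of_all _ fun x => (P.w_pos x).le)]
    exact ENNReal.ofReal_lt_top

theorem integrable_w_occupation (hw : Integrable P.w p) :
    Integrable (fun y : P.State × Bool => P.w y.1) (P.occupation p π) := by
  refine ⟨(P.w_measurable.comp measurable_fst).aestronglyMeasurable, ?_⟩
  refine (hasFiniteIntegral_iff_ofReal
    (ae_of_all _ fun y : P.State × Bool => (P.w_pos y.1).le)).2 ?_
  exact lintegral_w_occupation_lt_top p π hw

variable {p} in
theorem integrable_occupation (hw : Integrable P.w p) {φ : P.State × Bool → ℝ}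
    (hφ : Measurable φ) {C : ℝ} (hC : ∀ y, |φ y| ≤ C * P.w y.1) :
    Integrable φ (P.occupation p π) :=
  ((integrable_w_occupation p π hw).const_mul C).mono' hφ.aestronglyMeasurable
    (ae_of_all _ hC)

theorem isFiniteMeasure_occupation (hw : Integrable P.w p) :
    IsFiniteMeasure (P.occupation p π) := by
  have h := integrable_occupation (P := P) (p := p) π hw (φ := fun _ => 1) measurable_const
    (C := 1) (fun y => by simpa using P.one_le_w y.1)
  exact (integrable_const_iff_isFiniteMeasure one_ne_zero).1 h

variable {p} in
theorem value_eq_tsum (hw : Integrable P.w p) {φ : P.State × Bool → ℝ}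
    (hφ : Measurable φ) {C : ℝ} (hC : ∀ y, |φ y| ≤ C * P.w y.1) :
    P.value φ p π = ∑' t, P.β ^ t * ∫ y, φ y ∂(P.stateActionLaw p π t) := by
  rw [value, integral_tsum]
  · refine tsum_congr fun t => ?_
    rw [integral_const_mul, stateActionLaw, integral_map (measurable_pi_apply t).aemeasurable
      hφ.aestronglyMeasurable]
  · exact fun t => (measurable_const.mul (hφ.comp (measurable_pi_apply t))).aestronglyMeasurable
  · have h := (integrable_occupation π hw hφ hC).2
    rw [HasFiniteIntegral, lintegral_occupation] at h
    convert h.ne using 3 with t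
    rw [stateActionLaw, lintegral_map hφ.enorm (by fun_prop), ← lintegral_const_mul _ (by fun_prop)]
    refine lintegral_congr fun ω => ?_
    rw [enorm_mul, Real.enorm_eq_ofReal (pow_nonneg P.β_nonneg t)]

variable {p} in
theorem integral_occupation (hw : Integrable P.w p) {φ : P.State × Bool → ℝ}
    (hφ : Measurable φ) {C : ℝ} (hC : ∀ y, |φ y| ≤ C * P.w y.1) :
    ∫ y, φ y ∂(P.occupation p π) = ∑' t, P.β ^ t * ∫ y, φ y ∂(P.stateActionLaw p π t) := by
  have h := integrable_occupation π hw hφ hC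
  rw [occupation] at h ⊢
  rw [integral_sum_measure h]
  refine tsum_congr fun t => ?_
  rw [integral_smul_measure, ENNReal.toReal_ofReal (pow_nonneg P.β_nonneg t), smul_eq_mul]

variable {p} in
theorem value_eq_integral_occupation (hw : Integrable P.w p) {φ : P.State × Bool → ℝ}
    (hφ : Measurable φ) {C : ℝ} (hC : ∀ y, |φ y| ≤ C * P.w y.1) :
    P.value φ p π = ∫ y, φ y ∂(P.occupation p π) := by
  rw [value_eq_tsum π hw hφ hC, integral_occupation π hw hφ hC]

/-- Balance equation: the time-0 term contributes p, and each later state law is the image under κ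
of the preceding state-action law, which costs one factor β. -/
theorem fst_occupation :
    (P.occupation p π).fst = p + ENNReal.ofReal P.β • (P.κ ∘ₘ P.occupation p π) := by
  refine Measure.ext_of_lintegral _ fun ψ hψ => ?_
  have h (t : ℕ) : ∫⁻ y, ψ y.1 ∂(P.stateActionLaw p π t) =
      ∫⁻ x, ψ x ∂(P.stateActionLaw p π t).fst := by
    rw [Measure.fst, lintegral_map hψ measurable_fst]
  rw [Measure.fst, lintegral_map hψ measurable_fst, lintegral_add_measure, lintegral_smul_measure,
    Measure.lintegral_bind (by fun_prop) hψ.aemeasurable, lintegral_occupation,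
    lintegral_occupation, tsum_eq_zero_add' ENNReal.summable, h, fst_stateActionLaw_zero,
    smul_eq_mul, ← ENNReal.tsum_mul_left]
  simp only [pow_zero, ENNReal.ofReal_one, one_mul]
  congr 1
  refine tsum_congr fun t => ?_
  rw [h, fst_stateActionLaw_succ, Measure.lintegral_bind (by fun_prop) hψ.aemeasurable,
    pow_succ', ENNReal.ofReal_mul P.β_nonneg, mul_assoc]

variable (P) in
/-- The expected one-period payoff plus the discounted expected continuation value `v`. -/
def actionValue (φ : P.State × Bool → ℝ) (v : P.State → ℝ) (y : P.State × Bool) : ℝ :=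
  φ y + P.β * ∫ x, v x ∂(P.κ y)

theorem measurable_actionValue {φ : P.State × Bool → ℝ} (hφ : Measurable φ) {v : P.State → ℝ}
    (hv : Measurable v) : Measurable (P.actionValue φ v) :=
  hφ.add (hv.stronglyMeasurable.integral_kernel.measurable.const_mul _)

theorem integrable_κ {v : P.State → ℝ} (hv : Measurable v) {C : ℝ} (hC : ∀ x, |v x| ≤ C * P.w x)
    (y : P.State × Bool) : Integrable v (P.κ y) :=
  ((P.w_integrable y.1 y.2).const_mul C).mono' hv.aestronglyMeasurable (ae_of_all _ hC)

theorem nonneg_of_abs_le {C : ℝ} {z : ℝ} {x : P.State} (h : |z| ≤ C * P.w x) : 0 ≤ C :=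
  nonneg_of_mul_nonneg_left ((abs_nonneg _).trans h) (P.w_pos x)

theorem abs_β_mul_integral_le {v : P.State → ℝ} {C : ℝ} (hC : ∀ x, |v x| ≤ C * P.w x)
    (y : P.State × Bool) : |P.β * ∫ x, v x ∂(P.κ y)| ≤ P.rate * C * P.w y.1 := by
  have hC0 : 0 ≤ C := nonneg_of_abs_le (hC y.1)
  rw [abs_mul, abs_of_nonneg P.β_nonneg]
  calc P.β * |∫ x, v x ∂(P.κ y)| ≤ P.β * ∫ x, C * P.w x ∂(P.κ y) := by
        refine mul_le_mul_of_nonneg_left ?_ P.β_nonneg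
        exact norm_integral_le_of_norm_le ((P.w_integrable y.1 y.2).const_mul C)
          (ae_of_all _ fun x => (Real.norm_eq_abs _).trans_le (hC x))
    _ = C * (P.β * ∫ x, P.w x ∂(P.κ y)) := by rw [integral_const_mul]; ring
    _ ≤ C * (P.rate * P.w y.1) := mul_le_mul_of_nonneg_left (P.β_mul_integral_w_le y) hC0
    _ = _ := by ring

theorem abs_actionValue_le {φ : P.State × Bool → ℝ} {C : ℝ} (hC : ∀ y, |φ y| ≤ C * P.w y.1)
    {v : P.State → ℝ} {D : ℝ} (hD : ∀ x, |v x| ≤ D * P.w x) (y : P.State × Bool) :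
    |P.actionValue φ v y| ≤ (C + P.rate * D) * P.w y.1 := by
  rw [add_mul]
  exact (abs_add_le _ _).trans (add_le_add (hC y) (abs_β_mul_integral_le hD y))

variable {p} in
theorem integral_fst_occupation (hw : Integrable P.w p) {v : P.State → ℝ} (hv : Measurable v)
    {C : ℝ} (hC : ∀ x, |v x| ≤ C * P.w x) :
    ∫ y, v y.1 ∂(P.occupation p π) =
      ∫ x, v x ∂p + ∫ y, P.β * ∫ x, v x ∂(P.κ y) ∂(P.occupation p π) := by
  have hint : Integrable v (P.occupation p π).fst :=
    (integrable_map_measure hv.aestronglyMeasurable measurable_fst.aemeasurable).2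
      (integrable_occupation π hw (hv.comp measurable_fst) fun y => hC y.1)
  have h1 : ∫ y, v y.1 ∂(P.occupation p π) = ∫ x, v x ∂(P.occupation p π).fst := by
    rw [Measure.fst, integral_map measurable_fst.aemeasurable hv.aestronglyMeasurable]
  rw [fst_occupation] at hint h1
  obtain ⟨i1, i2⟩ := integrable_add_measure.1 hint
  rw [h1, integral_add_measure i1 i2, integral_smul_measure, ENNReal.toReal_ofReal P.β_nonneg,
    integral_const_mul, smul_eq_mul]
  -- If β = 0, integrability for the scaled measure says nothing about the unscaled one, but both
  -- terms vanish.
  rcases P.β_nonneg.eq_or_lt with h0 | h0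
  · simp [← h0]
  · rw [integrable_smul_measure (by simpa using h0) ENNReal.ofReal_ne_top] at i2
    rw [Measure.comp_eq_comp_const_apply] at i2 ⊢
    rw [Kernel.integral_comp i2, Kernel.const_apply]

variable {p} in
-- The balance equation tested on v. Below, v is the value function of another policy, and the
-- integrand becomes its one-step advantage.
theorem value_eq_integral_add (hw : Integrable P.w p) {φ : P.State × Bool → ℝ}
    (hφ : Measurable φ) {C : ℝ} (hC : ∀ y, |φ y| ≤ C * P.w y.1) {v : P.State → ℝ}
    (hv : Measurable v) {D : ℝ} (hD : ∀ x, |v x| ≤ D * P.w x) :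
    P.value φ p π = ∫ x, v x ∂p +
      ∫ y, (P.actionValue φ v y - v y.1) ∂(P.occupation p π) := by
  have i1 := integrable_occupation π hw hφ hC
  have i2 : Integrable (fun y => P.β * ∫ x, v x ∂(P.κ y)) (P.occupation p π) :=
    integrable_occupation π hw (hv.stronglyMeasurable.integral_kernel.measurable.const_mul _)
      (abs_β_mul_integral_le hD)
  have i3 : Integrable (fun y : P.State × Bool => v y.1) (P.occupation p π) :=
    integrable_occupation π hw (hv.comp measurable_fst) fun y => hD y.1
  have h := integral_fst_occupation π hw hv hD
  rw [value_eq_integral_occupation π hw hφ hC]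
  unfold actionValue
  have e1 := integral_sub (i1.add i2) i3
  have e2 := integral_add i1 i2
  simp only [Pi.add_apply] at e1 e2
  rw [e1, e2, h]
  ring

end Project

/-! ### Stationary randomized policies -/

namespace Policy

variable {X : Type*} [MeasurableSpace X]

/-- The kernel that takes action `1` in state `x` with probability `θ x`. -/
def bernoulliKernel (θ : X → unitInterval) (hθ : Measurable θ) : Kernel X Bool where
  toFun x := ENNReal.ofReal (θ x) • Measure.dirac true +
    ENNReal.ofReal (1 - θ x) • Measure.dirac false
  measurable' := by
    refine Measure.measurable_of_measurable_coe _ fun s _ => ?_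
    simp only [Measure.coe_add, Measure.coe_smul, Pi.add_apply, Pi.smul_apply, smul_eq_mul]
    have h : Measurable fun x => (θ x : ℝ) := measurable_subtype_coe.comp hθ
    fun_prop

theorem bernoulliKernel_apply (θ : X → unitInterval) (hθ : Measurable θ) (x : X) :
    bernoulliKernel θ hθ x = ENNReal.ofReal (θ x) • Measure.dirac true +
      ENNReal.ofReal (1 - θ x) • Measure.dirac false := rfl

instance (θ : X → unitInterval) (hθ : Measurable θ) : IsMarkovKernel (bernoulliKernel θ hθ) := by
  refine ⟨fun x => ⟨?_⟩⟩
  rw [bernoulliKernel_apply]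
  simp only [Measure.coe_add, Measure.coe_smul, Pi.add_apply, Pi.smul_apply, measure_univ,
    smul_eq_mul, mul_one]
  rw [← ENNReal.ofReal_add (θ x).2.1 (sub_nonneg.2 (θ x).2.2)]
  simp

theorem integral_bernoulliKernel (θ : X → unitInterval) (hθ : Measurable θ) (x : X)
    (φ : Bool → ℝ) :
    ∫ a, φ a ∂(bernoulliKernel θ hθ x) = θ x * φ true + (1 - θ x) * φ false := by
  rw [bernoulliKernel_apply, integral_add_measure, integral_smul_measure, integral_smul_measure,
    integral_dirac, integral_dirac, ENNReal.toReal_ofReal (θ x).2.1,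
    ENNReal.toReal_ofReal (sub_nonneg.2 (θ x).2.2), smul_eq_mul, smul_eq_mul]
  · exact (integrable_dirac (by simp)).smul_measure ENNReal.ofReal_ne_top
  · exact (integrable_dirac (by simp)).smul_measure ENNReal.ofReal_ne_top

/-- The stationary policy that takes action `1` in state `x` with probability `θ x`. -/
def randomized (θ : X → unitInterval) (hθ : Measurable θ) : Policy X where
  init := bernoulliKernel θ hθ
  step _ := (bernoulliKernel θ hθ).comap Prod.snd measurable_snd
  init_markov := inferInstance
  step_markov _ := inferInstance

/-- The activation probabilities of the deterministic policy with active region `B`. -/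
def regionRule (B : Set X) : X → unitInterval := B.indicator fun _ => 1

theorem measurable_regionRule {B : Set X} (hB : MeasurableSet B) : Measurable (regionRule B) :=
  measurable_const.indicator hB

omit [MeasurableSpace X] in
theorem regionRule_of_mem {B : Set X} {x : X} (h : x ∈ B) : regionRule B x = 1 :=
  indicator_of_mem h _

omit [MeasurableSpace X] in
theorem regionRule_of_notMem {B : Set X} {x : X} (h : x ∉ B) : regionRule B x = 0 :=
  indicator_of_notMem h _

theorem bernoulliKernel_regionRule {B : Set X} (hB : MeasurableSet B) :
    bernoulliKernel (regionRule B) (measurable_regionRule hB) =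
      Kernel.deterministic (regionAction B) (measurable_regionAction hB) := by
  ext1 x
  rw [bernoulliKernel_apply, Kernel.deterministic_apply]
  by_cases h : x ∈ B
  · simp [regionRule_of_mem h, regionAction, h]
  · simp [regionRule_of_notMem h, regionAction, h]

theorem ofRegion_eq_randomized {B : Set X} (hB : MeasurableSet B) :
    ofRegion B hB = randomized (regionRule B) (measurable_regionRule hB) := by
  simp only [ofRegion, randomized, bernoulliKernel_regionRule hB, Policy.mk.injEq, true_and]
  rfl

end Policy

/-! ### Value functions of stationary policies -/

namespace Project

variable {P : Project}

theorem stateActionLaw_randomized (p : Measure P.State) [IsProbabilityMeasure p]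
    {θ : P.State → unitInterval} (hθ : Measurable θ) (t : ℕ) :
    P.stateActionLaw p (Policy.randomized θ hθ) t =
      (P.stateActionLaw p (Policy.randomized θ hθ) t).fst ⊗ₘ Policy.bernoulliKernel θ hθ := by
  cases t with
  | zero => rw [fst_stateActionLaw_zero, stateActionLaw_zero]; rfl
  | succ t => exact stateActionLaw_succ_eq_compProd p _ t _ rfl

theorem stateActionLaw_prepend_succ (p : Measure P.State) [IsProbabilityMeasure p] (a : Bool)
    {θ : P.State → unitInterval} (hθ : Measurable θ) (t : ℕ) :
    P.stateActionLaw p ((Policy.randomized θ hθ).prepend a) (t + 1) =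
      (P.stateActionLaw p ((Policy.randomized θ hθ).prepend a) (t + 1)).fst ⊗ₘ
        Policy.bernoulliKernel θ hθ := by
  refine stateActionLaw_succ_eq_compProd p _ t _ ?_
  cases t <;> rfl

theorem occupation_randomized (p : Measure P.State) [IsProbabilityMeasure p]
    {θ : P.State → unitInterval} (hθ : Measurable θ) :
    P.occupation p (Policy.randomized θ hθ) =
      (P.occupation p (Policy.randomized θ hθ)).fst ⊗ₘ Policy.bernoulliKernel θ hθ := by
  refine Measure.ext_of_lintegral _ fun ψ hψ => ?_
  have hm : Measurable fun x => ∫⁻ a, ψ (x, a) ∂(Policy.bernoulliKernel θ hθ x) :=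
    hψ.lintegral_kernel_prod_right'
  have : SFinite (P.occupation p (Policy.randomized θ hθ)) := by
    unfold occupation; infer_instance
  rw [Measure.lintegral_compProd hψ, Measure.fst, lintegral_map hm measurable_fst,
    lintegral_occupation, lintegral_occupation]
  refine tsum_congr fun t => ?_
  conv_lhs => rw [stateActionLaw_randomized p hθ t, Measure.lintegral_compProd hψ, Measure.fst,
    lintegral_map hm measurable_fst]

/-- The one-step value operator of the stationary policy with activation probabilities `θ`. -/
def ruleOperator (φ : P.State × Bool → ℝ) (θ : P.State → unitInterval) (v : P.State → ℝ)
    (x : P.State) : ℝ :=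
  θ x * P.actionValue φ v (x, true) + (1 - θ x) * P.actionValue φ v (x, false)

theorem measurable_ruleOperator {φ : P.State × Bool → ℝ} (hφ : Measurable φ)
    {θ : P.State → unitInterval} (hθ : Measurable θ) {v : P.State → ℝ} (hv : Measurable v) :
    Measurable (ruleOperator φ θ v) := by
  have h : Measurable fun x => (θ x : ℝ) := measurable_subtype_coe.comp hθ
  have h2 := measurable_actionValue hφ hv
  exact (h.mul (h2.comp measurable_prodMk_right)).add
    ((measurable_const.sub h).mul (h2.comp measurable_prodMk_right))

theorem abs_convex_combination_le {q a b C : ℝ} (h0 : 0 ≤ q) (h1 : q ≤ 1) (ha : |a| ≤ C)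
    (hb : |b| ≤ C) : |q * a + (1 - q) * b| ≤ C := by
  rw [abs_le] at *
  constructor <;> nlinarith

theorem abs_ruleOperator_le {φ : P.State × Bool → ℝ} {C : ℝ} (hC : ∀ y, |φ y| ≤ C * P.w y.1)
    (θ : P.State → unitInterval) {v : P.State → ℝ} {D : ℝ} (hD : ∀ x, |v x| ≤ D * P.w x)
    (x : P.State) : |ruleOperator φ θ v x| ≤ (C + P.rate * D) * P.w x :=
  abs_convex_combination_le (θ x).2.1 (θ x).2.2 (abs_actionValue_le hC hD (x, true))
    (abs_actionValue_le hC hD (x, false))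

theorem actionValue_sub (φ : P.State × Bool → ℝ) {v v' : P.State → ℝ} (hv : Measurable v)
    (hv' : Measurable v') {D D' : ℝ} (hD : ∀ x, |v x| ≤ D * P.w x)
    (hD' : ∀ x, |v' x| ≤ D' * P.w x) (y : P.State × Bool) :
    P.actionValue φ v y - P.actionValue φ v' y = P.β * ∫ x, (v x - v' x) ∂(P.κ y) := by
  rw [integral_sub (integrable_κ hv hD y) (integrable_κ hv' hD' y)]
  simp only [actionValue]
  ring

theorem abs_ruleOperator_sub_le (φ : P.State × Bool → ℝ)
    (θ : P.State → unitInterval) {v v' : P.State → ℝ} (hv : Measurable v)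
    (hv' : Measurable v') {D D' E : ℝ} (hD : ∀ x, |v x| ≤ D * P.w x)
    (hD' : ∀ x, |v' x| ≤ D' * P.w x) (hE : ∀ x, |v x - v' x| ≤ E * P.w x) (x : P.State) :
    |ruleOperator φ θ v x - ruleOperator φ θ v' x| ≤ P.rate * E * P.w x := by
  have h : ruleOperator φ θ v x - ruleOperator φ θ v' x =
      θ x * (P.actionValue φ v (x, true) - P.actionValue φ v' (x, true)) +
      (1 - θ x) * (P.actionValue φ v (x, false) - P.actionValue φ v' (x, false)) := by
    simp only [ruleOperator]; ring
  rw [h, actionValue_sub φ hv hv' hD hD', actionValue_sub φ hv hv' hD hD']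
  exact abs_convex_combination_le (θ x).2.1 (θ x).2.2 (abs_β_mul_integral_le hE (x, true))
    (abs_β_mul_integral_le hE (x, false))

/-- Value iteration from 0 contracts in the w-weighted sup norm with factor `P.rate`. The iterates
are Cauchy at each state, and dominated convergence carries the limit through the operator. -/
theorem exists_ruleOperator_fixedPoint {φ : P.State × Bool → ℝ} (hφ : Measurable φ) {C : ℝ}
    (hC : ∀ y, |φ y| ≤ C * P.w y.1) {θ : P.State → unitInterval} (hθ : Measurable θ) :
    ∃ v : P.State → ℝ, Measurable v ∧ (∀ x, |v x| ≤ C / (1 - P.rate) * P.w x) ∧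
      ∀ x, ruleOperator φ θ v x = v x := by
  set D := C / (1 - P.rate) with hD
  have hr : 0 < 1 - P.rate := sub_pos.2 P.rate_lt_one
  -- D is the fixed point of D ↦ C + ρD, so the bound D·w reproduces itself along the iteration.
  have hDeq : C + P.rate * D = D := by rw [hD]; field_simp; ring
  let V : ℕ → P.State → ℝ := fun n => (ruleOperator φ θ)^[n] 0
  have hV (n : ℕ) : V (n + 1) = ruleOperator φ θ (V n) := Function.iterate_succ_apply' _ _ _
  have hVm (n : ℕ) : Measurable (V n) := by
    induction n with
    | zero => exact measurable_zero
    | succ n ih => rw [hV]; exact measurable_ruleOperator hφ hθ ih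
  have hVb (n : ℕ) : ∀ x, |V n x| ≤ D * P.w x := by
    induction n with
    | zero =>
      intro x
      have : 0 ≤ C := nonneg_of_abs_le (hC (x, true))
      have := P.w_pos x
      simp only [V, Function.iterate_zero, id, Pi.zero_apply, abs_zero]
      positivity
    | succ n ih =>
      intro x
      rw [hV, ← hDeq]
      exact abs_ruleOperator_le hC θ ih x
  have hVd (n : ℕ) : ∀ x, |V (n + 1) x - V n x| ≤ P.rate ^ n * D * P.w x := by
    induction n with
    | zero => intro x; simpa [V] using hVb 1 x
    | succ n ih =>
      intro x
      rw [hV (n + 1), hV n]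
      refine (abs_ruleOperator_sub_le φ θ (D := D) (E := P.rate ^ n * D) ?_ (hVm n) ?_ (hVb n)
        ?_ x).trans_eq (by ring)
      · rw [← hV]; exact hVm _
      · rw [← hV]; exact hVb _
      · rw [← hV]; exact ih
  have hlim (x : P.State) : ∃ z, Tendsto (fun n => V n x) atTop (𝓝 z) := by
    refine cauchySeq_tendsto_of_complete (cauchySeq_of_le_geometric P.rate (D * P.w x)
      P.rate_lt_one fun n => ?_)
    rw [dist_comm, Real.dist_eq]
    exact (hVd n x).trans_eq (by ring)
  choose v hv using hlim
  have hvm : Measurable v := measurable_of_tendsto_metrizable hVm (tendsto_pi_nhds.2 hv)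
  refine ⟨v, hvm, fun x => le_of_tendsto (hv x).abs (Eventually.of_forall fun n => hVb n x),
    fun x => ?_⟩
  have hq (y : P.State × Bool) :
      Tendsto (fun n => P.actionValue φ (V n) y) atTop (𝓝 (P.actionValue φ v y)) := by
    refine tendsto_const_nhds.add (Tendsto.const_mul _ ?_)
    exact tendsto_integral_of_dominated_convergence (fun x => D * P.w x)
      (fun n => (hVm n).aestronglyMeasurable) ((P.w_integrable y.1 y.2).const_mul D)
      (fun n => ae_of_all _ (hVb n)) (ae_of_all _ hv)
  have h1 : Tendsto (fun n => ruleOperator φ θ (V n) x) atTop (𝓝 (ruleOperator φ θ v x)) :=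
    ((hq _).const_mul _).add ((hq _).const_mul _)
  simp only [← hV] at h1
  exact tendsto_nhds_unique h1 ((tendsto_add_atTop_iff_nat 1).2 (hv x))

/-- The value of the stationary policy with activation probabilities `θ` as a function of the
initial state. -/
def ruleValue (φ : P.State × Bool → ℝ) {θ : P.State → unitInterval} (hθ : Measurable θ)
    (x : P.State) : ℝ :=
  P.value φ (Measure.dirac x) (Policy.randomized θ hθ)

theorem integrable_w_dirac (x : P.State) : Integrable P.w (Measure.dirac x) :=
  integrable_dirac (by simp)

section

variable {φ : P.State × Bool → ℝ} (hφ : Measurable φ) {C : ℝ} (hC : ∀ y, |φ y| ≤ C * P.w y.1)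
  {θ : P.State → unitInterval} (hθ : Measurable θ)

include hφ hC

/-- The advantage relative to v averages to zero under the policy's own action kernel, so only ∫ v
dp remains. -/
theorem value_randomized_of_fixedPoint {p : Measure P.State} [IsProbabilityMeasure p]
    (hw : Integrable P.w p) {v : P.State → ℝ} (hv : Measurable v) {D : ℝ}
    (hD : ∀ x, |v x| ≤ D * P.w x) (hfix : ∀ x, ruleOperator φ θ v x = v x) :
    P.value φ p (Policy.randomized θ hθ) = ∫ x, v x ∂p := by
  have : IsFiniteMeasure (P.occupation p (Policy.randomized θ hθ)) :=
    isFiniteMeasure_occupation p _ hw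
  rw [value_eq_integral_add _ hw hφ hC hv hD, add_eq_left, occupation_randomized p hθ,
    Measure.integral_compProd]
  · refine integral_eq_zero_of_ae (ae_of_all _ fun x => ?_)
    have h := hfix x
    simp only [ruleOperator] at h
    simp only [Policy.integral_bernoulliKernel, Pi.zero_apply]
    linarith
  · rw [← occupation_randomized p hθ]
    exact (integrable_occupation _ hw (measurable_actionValue hφ hv)
      (abs_actionValue_le hC hD)).sub
      (integrable_occupation _ hw (hv.comp measurable_fst) fun y => hD y.1)

theorem ruleValue_eq_of_fixedPoint {v : P.State → ℝ} (hv : Measurable v) {D : ℝ}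
    (hD : ∀ x, |v x| ≤ D * P.w x) (hfix : ∀ x, ruleOperator φ θ v x = v x) :
    ruleValue φ hθ = v := by
  ext x
  rw [ruleValue, value_randomized_of_fixedPoint hφ hC hθ (integrable_w_dirac x) hv hD hfix,
    integral_dirac]

theorem measurable_ruleValue : Measurable (ruleValue φ hθ) := by
  obtain ⟨v, hv, hD, hfix⟩ := exists_ruleOperator_fixedPoint hφ hC hθ
  rwa [ruleValue_eq_of_fixedPoint hφ hC hθ hv hD hfix]

theorem abs_ruleValue_le (x : P.State) : |ruleValue φ hθ x| ≤ C / (1 - P.rate) * P.w x := by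
  obtain ⟨v, hv, hD, hfix⟩ := exists_ruleOperator_fixedPoint hφ hC hθ
  rw [ruleValue_eq_of_fixedPoint hφ hC hθ hv hD hfix]
  exact hD x

theorem ruleOperator_ruleValue (x : P.State) :
    ruleOperator φ θ (ruleValue φ hθ) x = ruleValue φ hθ x := by
  obtain ⟨v, hv, hD, hfix⟩ := exists_ruleOperator_fixedPoint hφ hC hθ
  rw [ruleValue_eq_of_fixedPoint hφ hC hθ hv hD hfix]
  exact hfix x

theorem value_randomized {p : Measure P.State} [IsProbabilityMeasure p]
    (hw : Integrable P.w p) :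
    P.value φ p (Policy.randomized θ hθ) = ∫ x, ruleValue φ hθ x ∂p :=
  value_randomized_of_fixedPoint hφ hC hθ hw (measurable_ruleValue hφ hC hθ)
    (abs_ruleValue_le hφ hC hθ) (ruleOperator_ruleValue hφ hC hθ)

/-- Relative to the value function of the stationary policy, only the decision at time 0 has an
advantage; the terms from time 1 on average to zero. -/
theorem value_prepend_randomized (x : P.State) (a : Bool) :
    P.value φ (Measure.dirac x) ((Policy.randomized θ hθ).prepend a) =
      P.actionValue φ (ruleValue φ hθ) (x, a) := by
  have hv := measurable_ruleValue hφ hC hθ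
  have hD := abs_ruleValue_le hφ hC hθ
  have hm : Measurable fun y : P.State × Bool =>
      P.actionValue φ (ruleValue φ hθ) y - ruleValue φ hθ y.1 :=
    (measurable_actionValue hφ hv).sub (hv.comp measurable_fst)
  have hb : ∀ y : P.State × Bool, |P.actionValue φ (ruleValue φ hθ) y - ruleValue φ hθ y.1| ≤
      (C + P.rate * (C / (1 - P.rate)) + C / (1 - P.rate)) * P.w y.1 := fun y => by
    rw [add_mul]
    exact (abs_sub _ _).trans (add_le_add (abs_actionValue_le hC hD y) (hD y.1))
  rw [value_eq_integral_add _ (integrable_w_dirac x) hφ hC hv hD, integral_dirac,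
    integral_occupation _ (integrable_w_dirac x) hm hb, tsum_eq_single 0]
  · rw [stateActionLaw_zero]
    have : (Measure.dirac x) ⊗ₘ ((Policy.randomized θ hθ).prepend a).init =
        Measure.dirac (x, a) := by
      simp only [Policy.prepend]
      rw [Measure.compProd_const, Measure.dirac_prod_dirac]
    rw [this, integral_dirac]
    simp
  · intro t ht
    obtain ⟨t, rfl⟩ := Nat.exists_eq_succ_of_ne_zero ht
    rw [Nat.succ_eq_add_one, stateActionLaw_prepend_succ]
    -- Integrability need not be established: without it the integral is 0 by convention.
    by_cases hi : Integrable (fun y : P.State × Bool =>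
        P.actionValue φ (ruleValue φ hθ) y - ruleValue φ hθ y.1)
        ((P.stateActionLaw (Measure.dirac x) ((Policy.randomized θ hθ).prepend a) (t + 1)).fst ⊗ₘ
          Policy.bernoulliKernel θ hθ)
    · rw [Measure.integral_compProd hi, integral_eq_zero_of_ae, mul_zero]
      refine ae_of_all _ fun x => ?_
      have h := ruleOperator_ruleValue hφ hC hθ x
      simp only [ruleOperator] at h
      simp only [Policy.integral_bernoulliKernel, Pi.zero_apply]
      linarith
    · rw [integral_undef hi, mul_zero]

end

/-- The difference between the values of the two actions when the stationary policy with activation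
probabilities `θ` is followed afterwards. -/
def marginalValue (φ : P.State × Bool → ℝ) {θ : P.State → unitInterval} (hθ : Measurable θ)
    (x : P.State) : ℝ :=
  P.actionValue φ (ruleValue φ hθ) (x, true) - P.actionValue φ (ruleValue φ hθ) (x, false)

variable (P) in
/-- A weighted bound of the marginal values of a one-period payoff with weighted bound `C`. -/
def marginalBound (C : ℝ) : ℝ := 2 * (C + P.rate * (C / (1 - P.rate)))

/-! ### Marginal values and the performance difference formula -/

section

variable {φ : P.State × Bool → ℝ} (hφ : Measurable φ) {C : ℝ} (hC : ∀ y, |φ y| ≤ C * P.w y.1)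
  {θ : P.State → unitInterval} (hθ : Measurable θ)

include hφ hC

theorem measurable_marginalValue : Measurable (marginalValue φ hθ) := by
  have h := measurable_actionValue hφ (measurable_ruleValue hφ hC hθ)
  exact (h.comp measurable_prodMk_right).sub (h.comp measurable_prodMk_right)

theorem abs_marginalValue_le (x : P.State) :
    |marginalValue φ hθ x| ≤ P.marginalBound C * P.w x := by
  have h := abs_actionValue_le hC (abs_ruleValue_le hφ hC hθ)
  refine (abs_sub _ _).trans ((add_le_add (h (x, true)) (h (x, false))).trans_eq ?_)
  simp only [marginalBound]
  ring

/-- The value at x is the θ(x)-average of the two action values, so an action's advantage is the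
marginal value times its deviation from θ(x). -/
theorem actionValue_sub_ruleValue (y : P.State × Bool) :
    P.actionValue φ (ruleValue φ hθ) y - ruleValue φ hθ y.1 =
      ((if y.2 then 1 else 0) - θ y.1) * marginalValue φ hθ y.1 := by
  obtain ⟨x, a⟩ := y
  have h := ruleOperator_ruleValue hφ hC hθ x
  simp only [ruleOperator] at h
  cases a <;> simp only [marginalValue, ← h, if_true, Bool.false_eq_true, if_false] <;> ring

theorem value_sub_value_randomized {p : Measure P.State} [IsProbabilityMeasure p]
    (hw : Integrable P.w p) (π : Policy P.State) :
    P.value φ p π - P.value φ p (Policy.randomized θ hθ) =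
      ∫ y, ((if y.2 then 1 else 0) - θ y.1) * marginalValue φ hθ y.1 ∂(P.occupation p π) := by
  rw [value_eq_integral_add π hw hφ hC (measurable_ruleValue hφ hC hθ)
    (abs_ruleValue_le hφ hC hθ), value_randomized hφ hC hθ hw, add_sub_cancel_left]
  exact integral_congr_ae (ae_of_all _ (actionValue_sub_ruleValue hφ hC hθ))

theorem abs_mul_marginalValue_le {q : ℝ} (hq : |q| ≤ 1) (x : P.State) :
    |q * marginalValue φ hθ x| ≤ P.marginalBound C * P.w x := by
  rw [abs_mul]
  exact (mul_le_of_le_one_left (abs_nonneg _) hq).trans (abs_marginalValue_le hφ hC hθ x)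

theorem integrable_value_sub {p : Measure P.State} [IsProbabilityMeasure p]
    (hw : Integrable P.w p) (π : Policy P.State) :
    Integrable (fun y : P.State × Bool =>
      ((if y.2 then 1 else 0) - (θ y.1 : ℝ)) * marginalValue φ hθ y.1) (P.occupation p π) := by
  have h1 : Measurable fun y : P.State × Bool => if y.2 then (1 : ℝ) else 0 :=
    (measurable_of_countable fun a : Bool => if a then (1 : ℝ) else 0).comp measurable_snd
  have h2 : Measurable fun y : P.State × Bool => (θ y.1 : ℝ) :=
    measurable_subtype_coe.comp (hθ.comp measurable_fst)
  refine integrable_occupation π hw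
    ((h1.sub h2).mul ((measurable_marginalValue hφ hC hθ).comp measurable_fst))
    fun y => abs_mul_marginalValue_le hφ hC hθ ?_ y.1
  have := (θ y.1).2.1
  have := (θ y.1).2.2
  rw [abs_le]
  split_ifs <;> constructor <;> linarith

omit hφ hC in
theorem abs_rule_sub_le {X : Type*} (θ θ' : X → unitInterval) (x : X) :
    |(θ' x : ℝ) - θ x| ≤ 1 := by
  have := (θ x).2.1
  have := (θ x).2.2
  have := (θ' x).2.1
  have := (θ' x).2.2
  rw [abs_le]
  constructor <;> linarith

theorem value_randomized_sub_value_randomized {p : Measure P.State} [IsProbabilityMeasure p]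
    (hw : Integrable P.w p) {θ' : P.State → unitInterval} (hθ' : Measurable θ') :
    P.value φ p (Policy.randomized θ' hθ') - P.value φ p (Policy.randomized θ hθ) =
      ∫ x, ((θ' x : ℝ) - θ x) * marginalValue φ hθ x
        ∂(P.occupation p (Policy.randomized θ' hθ')).fst := by
  have : IsFiniteMeasure (P.occupation p (Policy.randomized θ' hθ')) :=
    isFiniteMeasure_occupation p _ hw
  have hi := integrable_value_sub hφ hC hθ hw (Policy.randomized θ' hθ')
  rw [occupation_randomized p hθ'] at hi
  rw [value_sub_value_randomized hφ hC hθ hw]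
  conv_lhs => rw [occupation_randomized p hθ']
  rw [Measure.integral_compProd hi]
  refine integral_congr_ae (ae_of_all _ fun x => ?_)
  simp only [Policy.integral_bernoulliKernel, if_true, Bool.false_eq_true, if_false]
  ring

omit hφ hC in
theorem integrable_w_fst_occupation {p : Measure P.State} [IsProbabilityMeasure p]
    (hw : Integrable P.w p) (π : Policy P.State) : Integrable P.w (P.occupation p π).fst :=
  (integrable_map_measure P.w_measurable.aestronglyMeasurable measurable_fst.aemeasurable).2
    (integrable_w_occupation p π hw)

/-- The difference formula is used with the occupation measure of the limit policy, which is fixed,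
and the marginal values of the varying policies, which share one bound. Thus neither convergence of
occupation measures nor of marginal values is needed. -/
theorem tendsto_value_randomized {p : Measure P.State} [IsProbabilityMeasure p]
    (hw : Integrable P.w p) {ι : Type*} {l : Filter ι} [l.IsCountablyGenerated]
    {η : ι → P.State → unitInterval} (hη : ∀ i, Measurable (η i))
    (hlim : ∀ x, Tendsto (fun i => η i x) l (𝓝 (θ x))) :
    Tendsto (fun i => P.value φ p (Policy.randomized (η i) (hη i))) l
      (𝓝 (P.value φ p (Policy.randomized θ hθ))) := by
  have h : Tendsto (fun i => ∫ x, ((θ x : ℝ) - η i x) * marginalValue φ (hη i) x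
      ∂(P.occupation p (Policy.randomized θ hθ)).fst) l
      (𝓝 (∫ _, 0 ∂(P.occupation p (Policy.randomized θ hθ)).fst)) := by
    refine tendsto_integral_filter_of_dominated_convergence
      (fun x => P.marginalBound C * P.w x) (Eventually.of_forall fun i => ?_)
      (Eventually.of_forall fun i => ae_of_all _ fun x =>
        abs_mul_marginalValue_le hφ hC (hη i) (abs_rule_sub_le (η i) θ x) x)
      ((integrable_w_fst_occupation hw _).const_mul _)
      (ae_of_all _ fun x => ?_)
    · exact (((measurable_subtype_coe.comp hθ).sub (measurable_subtype_coe.comp (hη i))).mul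
        (measurable_marginalValue hφ hC (hη i))).aestronglyMeasurable
    · have h0 : Tendsto (fun i => |(θ x : ℝ) - η i x| * (P.marginalBound C * P.w x)) l (𝓝 0) := by
        have h1 : Tendsto (fun i => (η i x : ℝ)) l (𝓝 (θ x)) :=
          (continuous_subtype_val.tendsto _).comp (hlim x)
        simpa using ((h1.const_sub (θ x : ℝ)).abs).mul_const (P.marginalBound C * P.w x)
      refine squeeze_zero_norm (fun i => ?_) h0
      rw [norm_mul, Real.norm_eq_abs]
      exact mul_le_mul_of_nonneg_left (abs_marginalValue_le hφ hC (hη i) x) (abs_nonneg _)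
  have h2 := h.const_sub (P.value φ p (Policy.randomized θ hθ))
  simp only [integral_zero, sub_zero] at h2
  refine h2.congr fun i => ?_
  rw [← value_randomized_sub_value_randomized hφ hC (hη i) hw hθ]
  ring

end

end Project

/-! ### Lebesgue–Stieltjes integrals against antitone functions -/

section LebesgueStieltjes

variable {α : ℝ → ℝ} {L U : ℝ}

/-- The negative of an antitone right-continuous function, as a Stieltjes function. -/
def Antitone.negStieltjes (hα : Antitone α) (hc : ∀ x, ContinuousWithinAt α (Ici x) x) :
    StieltjesFunction ℝ :=
  ⟨fun x => -α x, hα.neg, fun x => (hc x).neg⟩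

theorem Antitone.negStieltjes_apply (hα : Antitone α)
    (hc : ∀ x, ContinuousWithinAt α (Ici x) x) (x : ℝ) : hα.negStieltjes hc x = -α x := rfl

theorem Antitone.negStieltjes_real_Ioc (hα : Antitone α)
    (hc : ∀ x, ContinuousWithinAt α (Ici x) x) {a b : ℝ} (hab : a ≤ b) :
    (hα.negStieltjes hc).measure.real (Ioc a b) = α a - α b := by
  rw [measureReal_def, StieltjesFunction.measure_Ioc,
    ENNReal.toReal_ofReal (sub_nonneg.2 ((hα.negStieltjes hc).mono hab)),
    hα.negStieltjes_apply hc, hα.negStieltjes_apply hc]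
  ring

/-- Ensures that `lsIntegral` is a genuine integral and not its default value 0. -/
theorem Antitone.boundedVariationOn_of_tendsto (hα : Antitone α)
    (hL : Tendsto α atBot (𝓝 L)) (hU : Tendsto α atTop (𝓝 U)) : BoundedVariationOn α univ := by
  have hbd : ∀ x, |(-α x)| ≤ max |L| |U| := fun x => by
    have h1 : α x ≤ L := hα.ge_of_tendsto hL x
    have h2 : U ≤ α x := hα.le_of_tendsto hU x
    rw [abs_neg, abs_le]
    refine ⟨?_, h1.trans ((le_abs_self L).trans (le_max_left _ _))⟩
    have := (neg_abs_le U)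
    have := le_max_right |L| |U|
    linarith
  have h : BoundedVariationOn (fun x => -α x) univ :=
    (hα.neg.monotoneOn univ).boundedVariationOn (C := max |L| |U|) fun x _ => hbd x
  have e : eVariationOn α univ = eVariationOn (fun x => -α x) univ := by
    refine iSup_congr fun q => Finset.sum_congr rfl fun i _ => ?_
    exact (edist_neg_neg (α (q.2.1 (i + 1))) (α (q.2.1 i))).symm
  unfold BoundedVariationOn
  rw [e]
  exact h

/-- Both sides agree on half-open intervals, a generating π-system, and on the whole line; the sign
appears because α decreases. -/
theorem Antitone.vectorMeasure_eq (hα : Antitone α)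
    (hc : ∀ x, ContinuousWithinAt α (Ici x) x) (hL : Tendsto α atBot (𝓝 L))
    (hU : Tendsto α atTop (𝓝 U)) (hbv : BoundedVariationOn α univ)
    [IsFiniteMeasure (hα.negStieltjes hc).measure] :
    hbv.vectorMeasure = -(hα.negStieltjes hc).measure.toSignedMeasure := by
  have hright (x : ℝ) : α.rightLim x = α x :=
    (hc x).rightLim_eq
  have hgen : (inferInstance : MeasurableSpace ℝ) =
      MeasurableSpace.generateFrom {S : Set ℝ | ∃ l u, l < u ∧ Ioc l u = S} :=
    (BorelSpace.measurable_eq (α := ℝ)).trans (borel_eq_generateFrom_Ioc ℝ)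
  have hpi : IsPiSystem {S : Set ℝ | ∃ l u, l < u ∧ Ioc l u = S} := isPiSystem_Ioc id id
  refine VectorMeasure.ext_of_generateFrom _ ?_ hgen hpi ?_
  · rintro _ ⟨l, u, hlu, rfl⟩
    rw [hbv.vectorMeasure_Ioc hlu.le, hright, hright, neg_apply,
      Measure.toSignedMeasure_apply_measurable measurableSet_Ioc,
      hα.negStieltjes_real_Ioc hc hlu.le]
    ring
  · have h0 : U ≤ L := (hα.le_of_tendsto hU 0).trans (hα.ge_of_tendsto hL 0)
    rw [hbv.vectorMeasure_univ, neg_apply,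
      Measure.toSignedMeasure_apply_measurable MeasurableSet.univ, measureReal_def,
      (hα.negStieltjes hc).measure_univ (l := -L) (u := -U) hL.neg hU.neg,
      ENNReal.toReal_ofReal (by linarith), hL.limUnder_eq, hU.limUnder_eq]
    ring

theorem Antitone.neg_lsIntegral_eq (hα : Antitone α)
    (hc : ∀ x, ContinuousWithinAt α (Ici x) x) (hL : Tendsto α atBot (𝓝 L))
    (hU : Tendsto α atTop (𝓝 U)) [IsFiniteMeasure (hα.negStieltjes hc).measure] (J : ℝ → ℝ)
    (a b : ℝ) :
    -lsIntegral (Ioc a b) J α = ∫ t in Ioc a b, J t ∂(hα.negStieltjes hc).measure := by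
  have hbv := hα.boundedVariationOn_of_tendsto hL hU
  rw [lsIntegral, dif_pos hbv, hα.vectorMeasure_eq hc hL hU hbv, VectorMeasure.restrict_neg,
    VectorMeasure.integral_neg_vectorMeasure, neg_neg,
    VectorMeasure.setIntegral_toSignedMeasure measurableSet_Ioc]

theorem Antitone.lsIntegral_bounds (hα : Antitone α)
    (hc : ∀ x, ContinuousWithinAt α (Ici x) x) (hL : Tendsto α atBot (𝓝 L))
    (hU : Tendsto α atTop (𝓝 U)) {J : ℝ → ℝ} (hJ : Monotone J) {a b : ℝ} (hab : a ≤ b) :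
    J a * (α a - α b) ≤ -lsIntegral (Ioc a b) J α ∧
      -lsIntegral (Ioc a b) J α ≤ J b * (α a - α b) := by
  have hS : IsFiniteMeasure (hα.negStieltjes hc).measure :=
    (hα.negStieltjes hc).isFiniteMeasure (l := -L) (u := -U) hL.neg hU.neg
  have hi : IntegrableOn J (Ioc a b) (hα.negStieltjes hc).measure := by
    refine Measure.integrableOn_of_bounded (M := max |J a| |J b|) (measure_ne_top _ _)
      hJ.measurable.aestronglyMeasurable ?_
    refine (ae_restrict_mem measurableSet_Ioc).mono fun x hx => ?_
    exact abs_le_max_abs_abs (hJ hx.1.le) (hJ hx.2)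
  have hconst (k : ℝ) :
      ∫ t in Ioc a b, k ∂(hα.negStieltjes hc).measure = k * (α a - α b) := by
    rw [setIntegral_const, hα.negStieltjes_real_Ioc hc hab, smul_eq_mul, mul_comm]
  rw [hα.neg_lsIntegral_eq hc hL hU, ← hconst, ← hconst]
  exact ⟨setIntegral_mono_on (integrable_const _) hi measurableSet_Ioc fun x hx => hJ hx.1.le,
    setIntegral_mono_on hi (integrable_const _) measurableSet_Ioc fun x hx => hJ hx.2⟩

/-- A function whose increments are bounded by products of increments of a continuous monotone and
an antitone function is antitone. -/
theorem antitone_of_sub_le_mul {ψ m D : ℝ → ℝ} (hm : Continuous m) (hD : Antitone D)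
    (h : ∀ s t, s ≤ t → ψ t - ψ s ≤ (m t - m s) * (D s - D t)) :
    Antitone ψ := by
  intro s t hst
  refine le_of_forall_pos_le_add fun ε hε => ?_
  -- η bounds the oscillation of m on each cell of the partition below; the summand 1 in the witness
  -- covers D s = D t.
  obtain ⟨η, hη, hηε⟩ : ∃ η > 0, η * (D s - D t) ≤ ε := by
    have h0 : 0 ≤ D s - D t := sub_nonneg.2 (hD hst)
    refine ⟨ε / (D s - D t + 1), by positivity, ?_⟩
    rw [div_mul_eq_mul_div, div_le_iff₀ (by positivity)]
    nlinarith
  have huc := isCompact_Icc.uniformContinuousOn_of_continuous (hm.continuousOn (s := Icc s t))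
  rw [Metric.uniformContinuousOn_iff] at huc
  obtain ⟨δ, hδ, hmδ⟩ := huc η hη
  obtain ⟨n, hn⟩ := exists_nat_gt ((t - s) / δ)
  have hn0 : (0 : ℝ) < n := (div_nonneg (sub_nonneg.2 hst) hδ.le).trans_lt hn
  set d := (t - s) / n with hd
  have hd0 : 0 ≤ d := div_nonneg (sub_nonneg.2 hst) hn0.le
  have hdδ : d < δ := by
    rw [hd, div_lt_iff₀ hn0]
    rw [div_lt_iff₀ hδ] at hn
    linarith
  have hnd : n * d = t - s := by rw [hd]; field_simp
  -- On each cell m grows by at most η, and the increments of D telescope.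
  have key (k : ℕ) (hk : k ≤ n) : ψ (s + k * d) - ψ s ≤ η * (D s - D (s + k * d)) := by
    induction k with
    | zero => simp
    | succ k ih =>
      have ih := ih (by omega)
      have hk' : ((k : ℝ) + 1) * d ≤ t - s := by
        rw [← hnd]
        exact mul_le_mul_of_nonneg_right (by exact_mod_cast hk) hd0
      have hkd : 0 ≤ (k : ℝ) * d := by positivity
      have e : s + ((k + 1 : ℕ) : ℝ) * d = s + k * d + d := by push_cast; ring
      rw [e]
      have h1 := h (s + k * d) (s + k * d + d) (by linarith)
      have h2 : m (s + k * d + d) - m (s + k * d) ≤ η := by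
        have := hmδ (s + k * d + d) ⟨by linarith, by linarith⟩ (s + k * d)
          ⟨by linarith, by linarith⟩ (by rw [Real.dist_eq]; simpa [abs_of_nonneg hd0] using hdδ)
        rw [Real.dist_eq] at this
        exact (le_abs_self _).trans this.le
      have h3 := mul_le_mul_of_nonneg_right h2
        (sub_nonneg.2 (hD (show s + k * d ≤ s + k * d + d by linarith)))
      nlinarith
  have hfin := key n le_rfl
  rw [hnd, add_sub_cancel] at hfin
  linarith

end LebesgueStieltjes

/-! ### Threshold policies as stationary rules -/

namespace Project

variable (P : Project)

/-- The one-period reward as a function of state-action pairs. -/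
def reward (y : P.State × Bool) : ℝ := P.r y.1 y.2

/-- The one-period resource consumption as a function of state-action pairs. -/
def resource (y : P.State × Bool) : ℝ := P.c y.1 y.2

theorem measurable_reward : Measurable P.reward :=
  measurable_from_prod_countable_left fun a => (P.r_continuous a).measurable

theorem measurable_resource : Measurable P.resource :=
  measurable_from_prod_countable_left fun a => (P.c_continuous a).measurable

theorem abs_reward_le (y : P.State × Bool) : |P.reward y| ≤ P.bound * P.w y.1 :=
  (le_max_left _ _).trans (P.max_le_bound y.1 y.2)

theorem abs_resource_le (y : P.State × Bool) : |P.resource y| ≤ P.bound * P.w y.1 := by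
  have h : 0 ≤ P.c y.1 y.2 := by
    have h0 := P.c_passive_nonneg y.1
    cases y.2
    · exact h0
    · exact h0.trans (P.c_passive_lt_active y.1).le
  rw [resource, abs_of_nonneg h]
  exact (le_max_right _ _).trans (P.max_le_bound y.1 y.2)

theorem F_eq_value (p : Measure P.State) (π : Policy P.State) :
    P.F p π = P.value P.reward p π := rfl

theorem G_eq_value (p : Measure P.State) (π : Policy P.State) :
    P.G p π = P.value P.resource p π := rfl

theorem measurable_coe_state : Measurable fun x : P.State => ((x : ℝ) : EReal) :=
  measurable_coe_real_ereal.comp measurable_subtype_coe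

/-- The activation probabilities of the `z`-policy. -/
def thresholdRule (z : EReal) : P.State → unitInterval :=
  Policy.regionRule {x | z < ((x : ℝ) : EReal)}

/-- The activation probabilities of the `z⁻`-policy. -/
def thresholdLeftRule (z : EReal) : P.State → unitInterval :=
  Policy.regionRule {x | z ≤ ((x : ℝ) : EReal)}

theorem measurable_thresholdRule (z : EReal) : Measurable (P.thresholdRule z) :=
  Policy.measurable_regionRule (measurableSet_lt measurable_const P.measurable_coe_state)

theorem measurable_thresholdLeftRule (z : EReal) : Measurable (P.thresholdLeftRule z) :=
  Policy.measurable_regionRule (measurableSet_le measurable_const P.measurable_coe_state)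

theorem threshold_eq (z : EReal) :
    P.threshold z = Policy.randomized (P.thresholdRule z) (P.measurable_thresholdRule z) :=
  Policy.ofRegion_eq_randomized _

theorem thresholdLeft_eq (z : EReal) : P.thresholdLeft z =
    Policy.randomized (P.thresholdLeftRule z) (P.measurable_thresholdLeftRule z) :=
  Policy.ofRegion_eq_randomized _

variable {P}

theorem thresholdRule_of_lt {z : EReal} {x : P.State} (h : z < ((x : ℝ) : EReal)) :
    P.thresholdRule z x = 1 :=
  Policy.regionRule_of_mem h

theorem thresholdRule_of_le {z : EReal} {x : P.State} (h : ((x : ℝ) : EReal) ≤ z) :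
    P.thresholdRule z x = 0 :=
  Policy.regionRule_of_notMem h.not_gt

theorem thresholdLeftRule_of_le {z : EReal} {x : P.State} (h : z ≤ ((x : ℝ) : EReal)) :
    P.thresholdLeftRule z x = 1 :=
  Policy.regionRule_of_mem h

theorem thresholdLeftRule_of_lt {z : EReal} {x : P.State} (h : ((x : ℝ) : EReal) < z) :
    P.thresholdLeftRule z x = 0 :=
  Policy.regionRule_of_notMem h.not_ge

theorem f_threshold (x : P.State) (z : EReal) :
    P.f x (P.threshold z) = marginalValue P.reward (P.measurable_thresholdRule z) x := by
  rw [f, threshold_eq, F_eq_value, F_eq_value,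
    value_prepend_randomized P.measurable_reward P.abs_reward_le,
    value_prepend_randomized P.measurable_reward P.abs_reward_le, marginalValue]

theorem g_threshold (x : P.State) (z : EReal) :
    P.g x (P.threshold z) = marginalValue P.resource (P.measurable_thresholdRule z) x := by
  rw [g, threshold_eq, G_eq_value, G_eq_value,
    value_prepend_randomized P.measurable_resource P.abs_resource_le,
    value_prepend_randomized P.measurable_resource P.abs_resource_le, marginalValue]

theorem F_dirac_threshold (x : P.State) (z : EReal) : P.F (Measure.dirac x) (P.threshold z) =
    ruleValue P.reward (P.measurable_thresholdRule z) x := by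
  rw [threshold_eq]; rfl

theorem G_dirac_threshold (x : P.State) (z : EReal) : P.G (Measure.dirac x) (P.threshold z) =
    ruleValue P.resource (P.measurable_thresholdRule z) x := by
  rw [threshold_eq]; rfl

/-! ### Monotonicity of the resource metric in the active region -/

section ResourceMonotonicity

variable (hP : P.PCLIndexable) {p : Measure P.State} [IsProbabilityMeasure p]
  (hw : Integrable P.w p)

theorem PCLIndexable.marginalValue_resource_pos (hP : P.PCLIndexable) (x : P.State) (z : EReal) :
    0 < marginalValue P.resource (P.measurable_thresholdRule z) x := by
  rw [← g_threshold]
  exact hP.marginal_resource_pos x z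

include hP hw

theorem G_threshold_top_le (π : Policy P.State) : P.G p (P.threshold ⊤) ≤ P.G p π := by
  rw [threshold_eq, ← sub_nonneg, G_eq_value, G_eq_value,
    value_sub_value_randomized P.measurable_resource P.abs_resource_le _ hw]
  refine integral_nonneg fun y => ?_
  rw [thresholdRule_of_le le_top]
  refine mul_nonneg ?_ (hP.marginalValue_resource_pos _ _).le
  split_ifs <;> simp

theorem G_le_threshold_bot (π : Policy P.State) : P.G p π ≤ P.G p (P.threshold ⊥) := by
  rw [threshold_eq, ← sub_nonpos, G_eq_value, G_eq_value,
    value_sub_value_randomized P.measurable_resource P.abs_resource_le _ hw]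
  refine integral_nonpos fun y => ?_
  rw [thresholdRule_of_lt (EReal.bot_lt_coe _)]
  refine mul_nonpos_of_nonpos_of_nonneg ?_ (hP.marginalValue_resource_pos _ _).le
  split_ifs <;> simp

theorem G_threshold_le_randomized {z : EReal} {θ : P.State → unitInterval} (hθ : Measurable θ)
    (h : ∀ x, P.thresholdRule z x ≤ θ x) :
    P.G p (P.threshold z) ≤ P.G p (Policy.randomized θ hθ) := by
  rw [threshold_eq, ← sub_nonneg, G_eq_value, G_eq_value,
    value_randomized_sub_value_randomized P.measurable_resource P.abs_resource_le _ hw]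
  exact integral_nonneg fun x =>
    mul_nonneg (sub_nonneg.2 (h x)) (hP.marginalValue_resource_pos _ _).le

theorem G_randomized_le_threshold {z : EReal} {θ : P.State → unitInterval} (hθ : Measurable θ)
    (h : ∀ x, θ x ≤ P.thresholdRule z x) :
    P.G p (Policy.randomized θ hθ) ≤ P.G p (P.threshold z) := by
  rw [threshold_eq, ← sub_nonpos, G_eq_value, G_eq_value,
    value_randomized_sub_value_randomized P.measurable_resource P.abs_resource_le _ hw]
  exact integral_nonpos fun x =>
    mul_nonpos_of_nonpos_of_nonneg (sub_nonpos.2 (h x)) (hP.marginalValue_resource_pos _ _).le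

/-- Strictness holds because the state marginal of the occupation measure dominates p, its time-0
term, and g is strictly positive. -/
theorem G_threshold_lt_randomized {z : EReal} {θ : P.State → unitInterval} (hθ : Measurable θ)
    (h : ∀ x, P.thresholdRule z x ≤ θ x) {S : Set P.State} (hS : 0 < p S)
    (hlt : ∀ x ∈ S, P.thresholdRule z x < θ x) :
    P.G p (P.threshold z) < P.G p (Policy.randomized θ hθ) := by
  rw [threshold_eq, ← sub_pos, G_eq_value, G_eq_value,
    value_randomized_sub_value_randomized P.measurable_resource P.abs_resource_le _ hw]
  have hg := hP.marginalValue_resource_pos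
  rw [integral_pos_iff_support_of_nonneg]
  · refine hS.trans_le ?_
    rw [fst_occupation]
    refine le_trans ?_ (Measure.le_add_right le_rfl _)
    refine measure_mono fun x hx => ?_
    exact (mul_pos (sub_pos.2 (Subtype.coe_lt_coe.2 (hlt x hx))) (hg x z)).ne'
  · exact fun x => mul_nonneg (sub_nonneg.2 (h x)) (hg x z).le
  · refine ((integrable_w_fst_occupation hw _).const_mul (P.marginalBound P.bound)).mono' ?_
      (ae_of_all _ fun x => abs_mul_marginalValue_le P.measurable_resource P.abs_resource_le _
        (abs_rule_sub_le _ _ x) x)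
    exact (((measurable_subtype_coe.comp hθ).sub (measurable_subtype_coe.comp
      (P.measurable_thresholdRule z))).mul (measurable_marginalValue P.measurable_resource
        P.abs_resource_le _)).aestronglyMeasurable

theorem antitone_G_threshold : Antitone fun z : EReal => P.G p (P.threshold z) := by
  intro s t hst
  simp only [P.threshold_eq s]
  refine G_threshold_le_randomized hP hw _ fun x => ?_
  rcases lt_or_ge s ((x : ℝ) : EReal) with h | h
  · rw [thresholdRule_of_lt h]; exact unitInterval.le_one _
  · rw [thresholdRule_of_le (h.trans hst)]; exact unitInterval.nonneg _

theorem G_thresholdLeft_le_threshold {s t : EReal} (hst : s < t) :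
    P.G p (P.thresholdLeft t) ≤ P.G p (P.threshold s) := by
  rw [thresholdLeft_eq]
  refine G_randomized_le_threshold hP hw _ fun x => ?_
  rcases lt_or_ge s ((x : ℝ) : EReal) with h | h
  · rw [thresholdRule_of_lt h]; exact unitInterval.le_one _
  · rw [thresholdLeftRule_of_lt (h.trans_lt hst)]; exact unitInterval.nonneg _

theorem G_threshold_lt_threshold {s t : EReal} (hst : s ≤ t)
    (hS : 0 < p {x | s < ((x : ℝ) : EReal) ∧ ((x : ℝ) : EReal) ≤ t}) :
    P.G p (P.threshold t) < P.G p (P.threshold s) := by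
  rw [P.threshold_eq s]
  refine G_threshold_lt_randomized hP hw _ (fun x => ?_) hS fun x hx => ?_
  · rcases lt_or_ge s ((x : ℝ) : EReal) with h | h
    · rw [thresholdRule_of_lt h]; exact unitInterval.le_one _
    · rw [thresholdRule_of_le (h.trans hst)]; exact unitInterval.nonneg _
  · rw [thresholdRule_of_lt hx.1, thresholdRule_of_le hx.2]
    exact zero_lt_one

end ResourceMonotonicity

/-! ### One-sided limits of the resource metric in the threshold -/

section Limits

variable {p : Measure P.State} [IsProbabilityMeasure p]
  (hw : Integrable P.w p)

include hw

/-- Threshold rules take only the values 0 and 1, so pointwise convergence amounts to being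
eventually constant at each state. -/
theorem tendsto_G_threshold {ι : Type*} {l : Filter ι} [l.IsCountablyGenerated] {z : ι → EReal}
    {θ : P.State → unitInterval} (hθ : Measurable θ)
    (h : ∀ x, ∀ᶠ i in l, P.thresholdRule (z i) x = θ x) :
    Tendsto (fun i => P.G p (P.threshold (z i))) l (𝓝 (P.G p (Policy.randomized θ hθ))) := by
  simp only [threshold_eq, G_eq_value]
  exact tendsto_value_randomized P.measurable_resource P.abs_resource_le hθ hw _
    fun x => tendsto_const_nhds.congr' ((h x).mono fun i hi => hi.symm)

theorem tendsto_G_threshold_nhdsGE (z : ℝ) :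
    Tendsto (fun s : ℝ => P.G p (P.threshold s)) (𝓝[≥] z) (𝓝 (P.G p (P.threshold z))) := by
  rw [P.threshold_eq z]
  refine tendsto_G_threshold hw _ fun x => ?_
  rcases lt_or_ge z (x : ℝ) with h | h
  · filter_upwards [mem_nhdsWithin_of_mem_nhds (Iio_mem_nhds h)] with s hs
    rw [thresholdRule_of_lt (EReal.coe_lt_coe_iff.2 h),
      thresholdRule_of_lt (EReal.coe_lt_coe_iff.2 hs)]
  · filter_upwards [self_mem_nhdsWithin] with s hs
    rw [thresholdRule_of_le (EReal.coe_le_coe_iff.2 h),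
      thresholdRule_of_le (EReal.coe_le_coe_iff.2 (h.trans hs))]

theorem tendsto_G_threshold_nhdsLT (z : ℝ) :
    Tendsto (fun s : ℝ => P.G p (P.threshold s)) (𝓝[<] z) (𝓝 (P.G p (P.thresholdLeft z))) := by
  rw [P.thresholdLeft_eq z]
  refine tendsto_G_threshold hw _ fun x => ?_
  rcases le_or_gt z (x : ℝ) with h | h
  · filter_upwards [self_mem_nhdsWithin] with s hs
    rw [thresholdLeftRule_of_le (EReal.coe_le_coe_iff.2 h),
      thresholdRule_of_lt (EReal.coe_lt_coe_iff.2 (lt_of_lt_of_le hs h))]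
  · filter_upwards [mem_nhdsWithin_of_mem_nhds (Ioi_mem_nhds h)] with s hs
    rw [thresholdLeftRule_of_lt (EReal.coe_lt_coe_iff.2 h),
      thresholdRule_of_le (EReal.coe_le_coe_iff.2 (le_of_lt hs))]

theorem tendsto_G_threshold_atTop :
    Tendsto (fun s : ℝ => P.G p (P.threshold s)) atTop (𝓝 (P.G p (P.threshold ⊤))) := by
  rw [P.threshold_eq ⊤]
  refine tendsto_G_threshold hw _ fun x => ?_
  filter_upwards [eventually_ge_atTop (x : ℝ)] with s hs
  rw [thresholdRule_of_le (EReal.coe_le_coe_iff.2 hs), thresholdRule_of_le le_top]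

theorem tendsto_G_threshold_atBot :
    Tendsto (fun s : ℝ => P.G p (P.threshold s)) atBot (𝓝 (P.G p (P.threshold ⊥))) := by
  rw [P.threshold_eq ⊥]
  refine tendsto_G_threshold hw _ fun x => ?_
  filter_upwards [eventually_lt_atBot (x : ℝ)] with s hs
  rw [thresholdRule_of_lt (EReal.coe_lt_coe_iff.2 hs), thresholdRule_of_lt (EReal.bot_lt_coe _)]

end Limits

/-! ### Optimality of the z-policy at resource price m*(z) -/

section Index

theorem clamp_coe (x : P.State) : P.clamp (x : ℝ) = x := by
  apply Subtype.ext
  rw [← EReal.coe_eq_coe_iff]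
  refine (P.coe_clamp _).trans ?_
  rw [min_eq_left x.2.2, max_eq_right x.2.1]

theorem monotone_clamp : Monotone P.clamp := by
  intro s t hst
  refine Subtype.coe_le_coe.1 (EReal.coe_le_coe_iff.1 ?_)
  refine (P.coe_clamp s).trans_le (le_trans ?_ (P.coe_clamp t).ge)
  exact max_le_max le_rfl (min_le_min (EReal.coe_le_coe_iff.2 hst) le_rfl)

theorem continuous_clamp : Continuous P.clamp := by
  refine Continuous.subtype_mk ?_ _
  rw [EReal.isEmbedding_coe.continuous_iff]
  have h : Real.toEReal ∘ (fun z : ℝ => (max P.ℓ (min (z : EReal) P.u)).toReal) =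
      fun z : ℝ => max P.ℓ (min (z : EReal) P.u) := funext P.coe_clamp
  rw [h]
  exact continuous_const.max (continuous_coe_real_ereal.min continuous_const)

theorem PCLIndexable.monotone_mpIndexReal (hP : P.PCLIndexable) : Monotone P.mpIndexReal :=
  hP.index_monotone.comp monotone_clamp

theorem PCLIndexable.continuous_mpIndexReal (hP : P.PCLIndexable) : Continuous P.mpIndexReal :=
  hP.index_continuous.comp continuous_clamp

theorem PCLIndexable.mpIndexReal_mul_g (hP : P.PCLIndexable) (x : P.State) :
    P.mpIndexReal x * P.g x (P.threshold ((x : ℝ) : EReal)) =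
      P.f x (P.threshold ((x : ℝ) : EReal)) := by
  rw [mpIndexReal, clamp_coe, mpIndex,
    div_mul_cancel₀ _ (hP.marginal_resource_pos x _).ne']

/-- Condition (iii) enters the proof here: on (s, t] the integrand m* lies between m*(s) and m*(t),
while G(x,·) decreases. -/
theorem PCLIndexable.F_dirac_sub_bounds (hP : P.PCLIndexable) (x : P.State) {s t : ℝ}
    (hst : s ≤ t) :
    P.mpIndexReal s * (P.G (Measure.dirac x) (P.threshold s) -
        P.G (Measure.dirac x) (P.threshold t)) ≤
      P.F (Measure.dirac x) (P.threshold s) - P.F (Measure.dirac x) (P.threshold t) ∧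
    P.F (Measure.dirac x) (P.threshold s) - P.F (Measure.dirac x) (P.threshold t) ≤
      P.mpIndexReal t * (P.G (Measure.dirac x) (P.threshold s) -
        P.G (Measure.dirac x) (P.threshold t)) := by
  rcases hst.eq_or_lt with rfl | hlt
  · simp
  have hw := integrable_w_dirac x
  have hα : Antitone fun z : ℝ => P.G (Measure.dirac x) (P.threshold z) :=
    fun a b hab => antitone_G_threshold hP hw (EReal.coe_le_coe_iff.2 hab)
  have h := hα.lsIntegral_bounds (tendsto_G_threshold_nhdsGE hw) (tendsto_G_threshold_atBot hw)
    (tendsto_G_threshold_atTop hw) hP.monotone_mpIndexReal hst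
  rwa [← hP.reward_eq_integral x s t hlt, neg_sub] at h

/-- The value of taking the action of `y` first and following the `z`-policy afterwards. -/
def thresholdActionValue (φ : P.State × Bool → ℝ) (y : P.State × Bool) (z : ℝ) : ℝ :=
  P.actionValue φ (ruleValue φ (P.measurable_thresholdRule z)) y

theorem thresholdActionValue_sub {φ : P.State × Bool → ℝ} (hφ : Measurable φ) {C : ℝ}
    (hC : ∀ y, |φ y| ≤ C * P.w y.1) (y : P.State × Bool) (s t : ℝ) :
    thresholdActionValue φ y s - thresholdActionValue φ y t =
      P.β * ∫ x, (ruleValue φ (P.measurable_thresholdRule s) x -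
        ruleValue φ (P.measurable_thresholdRule t) x) ∂(P.κ y) :=
  actionValue_sub φ (measurable_ruleValue hφ hC _) (measurable_ruleValue hφ hC _)
    (abs_ruleValue_le hφ hC _) (abs_ruleValue_le hφ hC _) y

theorem integrable_ruleValue_κ {φ : P.State × Bool → ℝ} (hφ : Measurable φ) {C : ℝ}
    (hC : ∀ y, |φ y| ≤ C * P.w y.1) (y : P.State × Bool) (s : ℝ) :
    Integrable (ruleValue φ (P.measurable_thresholdRule s)) (P.κ y) :=
  integrable_κ (measurable_ruleValue hφ hC _) (abs_ruleValue_le hφ hC _) y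

theorem PCLIndexable.antitone_thresholdActionValue_resource (hP : P.PCLIndexable)
    (y : P.State × Bool) : Antitone (thresholdActionValue P.resource y) := by
  intro s t hst
  rw [← sub_nonneg, thresholdActionValue_sub P.measurable_resource P.abs_resource_le]
  refine mul_nonneg P.β_nonneg (integral_nonneg fun x => ?_)
  have h := antitone_G_threshold hP (integrable_w_dirac x) (EReal.coe_le_coe_iff.2 hst)
  simp only [G_dirac_threshold] at h
  exact sub_nonneg.2 h

/-- The bounds from single initial states integrate against κ, since the index factors do not depend
on the state; the immediate payoffs cancel. -/
theorem PCLIndexable.thresholdActionValue_reward_sub_bounds (hP : P.PCLIndexable)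
    (y : P.State × Bool) {s t : ℝ} (hst : s ≤ t) :
    P.mpIndexReal s * (thresholdActionValue P.resource y s -
        thresholdActionValue P.resource y t) ≤
      thresholdActionValue P.reward y s - thresholdActionValue P.reward y t ∧
    thresholdActionValue P.reward y s - thresholdActionValue P.reward y t ≤
      P.mpIndexReal t * (thresholdActionValue P.resource y s -
        thresholdActionValue P.resource y t) := by
  have hb (x : P.State) := hP.F_dirac_sub_bounds x hst
  simp only [F_dirac_threshold, G_dirac_threshold] at hb
  have hF := integrable_ruleValue_κ P.measurable_reward P.abs_reward_le y
  have hG := integrable_ruleValue_κ P.measurable_resource P.abs_resource_le y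
  have h1 := integral_mono (((hG s).sub (hG t)).const_mul (P.mpIndexReal s)) ((hF s).sub (hF t))
    fun x => (hb x).1
  have h2 := integral_mono ((hF s).sub (hF t)) (((hG s).sub (hG t)).const_mul (P.mpIndexReal t))
    fun x => (hb x).2
  rw [integral_const_mul] at h1 h2
  rw [thresholdActionValue_sub P.measurable_resource P.abs_resource_le,
    thresholdActionValue_sub P.measurable_reward P.abs_reward_le, mul_left_comm,
    mul_left_comm (P.mpIndexReal t)]
  exact ⟨mul_le_mul_of_nonneg_left h1 P.β_nonneg, mul_le_mul_of_nonneg_left h2 P.β_nonneg⟩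

/-- With G₁, G₀ the resource metrics after actions 1 and 0, the two-sided bounds give an increment
of at most (m*(t) − m*(s))(G₀(s) − G₁(t)). Since G₀(s) = G₁(s) − g(x,s) and g > 0, this is at most
(m*(t) − m*(s))(G₁(s) − G₁(t)). -/
theorem PCLIndexable.antitone_f_sub_index_mul_g (hP : P.PCLIndexable) (x : P.State) :
    Antitone fun z : ℝ =>
      P.f x (P.threshold z) - P.mpIndexReal z * P.g x (P.threshold z) := by
  refine antitone_of_sub_le_mul hP.continuous_mpIndexReal
    (hP.antitone_thresholdActionValue_resource (x, true)) fun s t hst => ?_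
  have h1 := (hP.thresholdActionValue_reward_sub_bounds (x, true) hst).1
  have h0 := (hP.thresholdActionValue_reward_sub_bounds (x, false) hst).2
  have hg := mul_nonneg (sub_nonneg.2 (hP.monotone_mpIndexReal hst))
    (hP.marginal_resource_pos x s).le
  simp only [f_threshold, g_threshold, marginalValue] at hg ⊢
  simp only [thresholdActionValue] at h1 h0 ⊢
  nlinarith

theorem PCLIndexable.marginal_nonneg_of_lt (hP : P.PCLIndexable) {x : P.State} {z : ℝ}
    (h : z < x) : 0 ≤ P.f x (P.threshold z) - P.mpIndexReal z * P.g x (P.threshold z) := by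
  have := hP.antitone_f_sub_index_mul_g x h.le
  simpa only [hP.mpIndexReal_mul_g x, sub_self] using this

theorem PCLIndexable.marginal_nonpos_of_le (hP : P.PCLIndexable) {x : P.State} {z : ℝ}
    (h : (x : ℝ) ≤ z) : P.f x (P.threshold z) - P.mpIndexReal z * P.g x (P.threshold z) ≤ 0 := by
  have := hP.antitone_f_sub_index_mul_g x h
  simpa only [hP.mpIndexReal_mul_g x, sub_self] using this

/-- In the difference formula, each deviation from the z-policy has the sign opposite to that of f −
m*(z) g, or is zero. -/
theorem PCLIndexable.F_sub_le (hP : P.PCLIndexable) {p : Measure P.State}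
    [IsProbabilityMeasure p] (hw : Integrable P.w p) (π : Policy P.State) (z : ℝ) :
    P.F p π - P.F p (P.threshold z) ≤
      P.mpIndexReal z * (P.G p π - P.G p (P.threshold z)) := by
  have iF := integrable_value_sub P.measurable_reward P.abs_reward_le
    (P.measurable_thresholdRule z) hw π
  have iG := integrable_value_sub P.measurable_resource P.abs_resource_le
    (P.measurable_thresholdRule z) hw π
  simp only [threshold_eq, F_eq_value, G_eq_value]
  rw [value_sub_value_randomized P.measurable_reward P.abs_reward_le _ hw,
    value_sub_value_randomized P.measurable_resource P.abs_resource_le _ hw,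
    ← integral_const_mul]
  refine integral_mono iF (iG.const_mul _) fun y => ?_
  simp only [← f_threshold, ← g_threshold]
  rcases lt_or_ge z (y.1 : ℝ) with h | h
  · have h1 := hP.marginal_nonneg_of_lt h
    rw [thresholdRule_of_lt (EReal.coe_lt_coe_iff.2 h)]
    split_ifs <;> simp only [Set.Icc.coe_one] <;> linarith
  · have h1 := hP.marginal_nonpos_of_le h
    rw [thresholdRule_of_le (EReal.coe_le_coe_iff.2 h)]
    split_ifs <;> simp only [Set.Icc.coe_zero] <;> linarith

/-- The rules differ only in the state z, where f = m* g exactly, so the Lagrangian inequality is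
tight. -/
theorem PCLIndexable.F_randomized_sub_eq (hP : P.PCLIndexable) {p : Measure P.State}
    [IsProbabilityMeasure p] (hw : Integrable P.w p) {θ : P.State → unitInterval}
    (hθ : Measurable θ) (z : ℝ) (h : ∀ x : P.State, (x : ℝ) ≠ z → θ x = P.thresholdRule z x) :
    P.F p (Policy.randomized θ hθ) - P.F p (P.threshold z) =
      P.mpIndexReal z * (P.G p (Policy.randomized θ hθ) - P.G p (P.threshold z)) := by
  simp only [threshold_eq, F_eq_value, G_eq_value]
  rw [value_randomized_sub_value_randomized P.measurable_reward P.abs_reward_le _ hw,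
    value_randomized_sub_value_randomized P.measurable_resource P.abs_resource_le _ hw,
    ← integral_const_mul]
  refine integral_congr_ae (ae_of_all _ fun x => ?_)
  simp only [← f_threshold, ← g_threshold]
  by_cases hx : (x : ℝ) = z
  · rw [← hx, ← hP.mpIndexReal_mul_g x]
    ring
  · simp [h x hx]

end Index

end Project

/-! ### Supporting lines of the optimal value function -/

namespace Project

variable {P : Project}

/-- The activation probabilities of the `z`-policy, modified to be `q` in the state `z`. -/
def tieRule (P : Project) (z : ℝ) (q : unitInterval) (x : P.State) : unitInterval :=
  open scoped Classical in if (x : ℝ) = z then q else P.thresholdRule z x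

theorem measurable_tieRule (z : ℝ) (q : unitInterval) : Measurable (P.tieRule z q) := by
  classical
  exact Measurable.ite (measurableSet_eq_fun measurable_subtype_coe measurable_const)
    measurable_const (P.measurable_thresholdRule z)

theorem tieRule_zero (z : ℝ) : P.tieRule z 0 = P.thresholdRule z := by
  ext1 x
  by_cases h : (x : ℝ) = z
  · rw [tieRule, if_pos h, thresholdRule_of_le (EReal.coe_le_coe_iff.2 h.le)]
  · rw [tieRule, if_neg h]

theorem tieRule_one (z : ℝ) : P.tieRule z 1 = P.thresholdLeftRule z := by
  ext1 x
  rcases lt_trichotomy (x : ℝ) z with h | h | h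
  · rw [tieRule, if_neg h.ne, thresholdRule_of_le (EReal.coe_le_coe_iff.2 h.le),
      thresholdLeftRule_of_lt (EReal.coe_lt_coe_iff.2 h)]
  · rw [tieRule, if_pos h, thresholdLeftRule_of_le (EReal.coe_le_coe_iff.2 h.ge)]
  · rw [tieRule, if_neg h.ne', thresholdRule_of_lt (EReal.coe_lt_coe_iff.2 h),
      thresholdLeftRule_of_le (EReal.coe_le_coe_iff.2 h.le)]

variable {p : Measure P.State} [IsProbabilityMeasure p]

/-- Intermediate value theorem in the activation probability q of the state z, which moves from the
z-policy to the z⁻-policy. -/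
theorem exists_tieRule_G_eq (hw : Integrable P.w p) {z γ : ℝ}
    (h1 : P.G p (P.threshold z) ≤ γ) (h2 : γ ≤ P.G p (P.thresholdLeft z)) :
    ∃ q, P.G p (Policy.randomized (P.tieRule z q) (measurable_tieRule z q)) = γ := by
  have hc : Continuous fun q =>
      P.G p (Policy.randomized (P.tieRule z q) (measurable_tieRule z q)) := by
    refine continuous_iff_continuousAt.2 fun q => ?_
    refine tendsto_value_randomized P.measurable_resource P.abs_resource_le
      (measurable_tieRule z q) hw _ fun x => ?_
    by_cases h : (x : ℝ) = z
    · simp only [tieRule, if_pos h]; exact tendsto_id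
    · simp only [tieRule, if_neg h]; exact tendsto_const_nhds
  refine intermediate_value_univ 0 1 hc ⟨?_, ?_⟩
  · simp only [tieRule_zero, ← threshold_eq]; exact h1
  · simp only [tieRule_one, ← thresholdLeft_eq]; exact h2

section

variable (hP : P.PCLIndexable) (hw : Integrable P.w p)

include hP hw

theorem Φ_le {γ z : ℝ} (hγ : γ ∈ P.resourceRegion p) :
    P.Φ p γ ≤ P.F p (P.threshold z) + P.mpIndexReal z * (γ - P.G p (P.threshold z)) := by
  -- Attainability of γ matters: the supremum of the empty set would be the default 0.
  refine csSup_le (Set.Nonempty.image _ hγ) ?_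
  rintro _ ⟨π, hπ, rfl⟩
  have h := hP.F_sub_le hw π z
  rw [show P.G p π = γ from hπ] at h
  linarith

theorem Φ_eq {γ z : ℝ} (h1 : P.G p (P.threshold z) ≤ γ) (h2 : γ ≤ P.G p (P.thresholdLeft z)) :
    P.Φ p γ = P.F p (P.threshold z) + P.mpIndexReal z * (γ - P.G p (P.threshold z)) := by
  obtain ⟨q, hq⟩ := exists_tieRule_G_eq hw h1 h2
  refine le_antisymm (Φ_le hP hw ⟨_, hq⟩) ?_
  have h := hP.F_randomized_sub_eq hw (measurable_tieRule z q) z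
    fun x hx => by rw [tieRule, if_neg hx]
  rw [hq, sub_eq_iff_eq_add'] at h
  rw [← h]
  refine le_csSup ⟨P.F p (P.threshold z) + P.mpIndexReal z * (γ - P.G p (P.threshold z)), ?_⟩
    ⟨_, hq, rfl⟩
  rintro _ ⟨π, hπ, rfl⟩
  have h := hP.F_sub_le hw π z
  rw [show P.G p π = γ from hπ] at h
  linarith

/-- Supergradient inequality: the supporting line at z touches Φ_p at γ. -/
theorem Φ_le_Φ_add {γ γ' z : ℝ} (h1 : P.G p (P.threshold z) ≤ γ)
    (h2 : γ ≤ P.G p (P.thresholdLeft z)) (hγ' : γ' ∈ P.resourceRegion p) :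
    P.Φ p γ' ≤ P.Φ p γ + P.mpIndexReal z * (γ' - γ) := by
  rw [Φ_eq hP hw h1 h2]
  exact (Φ_le hP hw hγ').trans_eq (by ring)

theorem interior_resourceRegion_subset :
    interior (P.resourceRegion p) ⊆ Ioo (P.G p (P.threshold ⊤)) (P.G p (P.threshold ⊥)) := by
  rw [← interior_Icc]
  refine interior_mono ?_
  rintro _ ⟨π, rfl⟩
  exact ⟨G_threshold_top_le hP hw π, G_le_threshold_bot hP hw π⟩

/-- The witness is the infimum of the thresholds with G(p,s) ≤ γ: right-continuity gives the first
inequality, the left limit G(p,z⁻) the second. -/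
theorem exists_threshold_bracket {γ : ℝ}
    (hγ : γ ∈ Ioo (P.G p (P.threshold ⊤)) (P.G p (P.threshold ⊥))) :
    ∃ z : ℝ, P.G p (P.threshold z) ≤ γ ∧ γ ≤ P.G p (P.thresholdLeft z) := by
  have hanti : Antitone fun s : ℝ => P.G p (P.threshold s) :=
    fun a b hab => antitone_G_threshold hP hw (EReal.coe_le_coe_iff.2 hab)
  set S : Set ℝ := {s | P.G p (P.threshold s) ≤ γ}
  have hne : S.Nonempty := by
    obtain ⟨s, hs⟩ := ((tendsto_G_threshold_atTop hw).eventually (gt_mem_nhds hγ.1)).exists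
    exact ⟨s, hs.le⟩
  have hbdd : BddBelow S := by
    obtain ⟨s, hs⟩ := ((tendsto_G_threshold_atBot hw).eventually (lt_mem_nhds hγ.2)).exists
    refine ⟨s, fun t ht => le_of_not_gt fun hts => ?_⟩
    exact (hs.trans_le (hanti hts.le)).not_ge ht
  refine ⟨sInf S, ?_, ?_⟩
  · refine le_of_tendsto ((tendsto_G_threshold_nhdsGE hw (sInf S)).mono_left
      (nhdsWithin_mono _ Ioi_subset_Ici_self)) ?_
    filter_upwards [self_mem_nhdsWithin] with s hs
    obtain ⟨t, ht, hts⟩ := exists_lt_of_csInf_lt hne hs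
    exact (hanti hts.le).trans ht
  · refine ge_of_tendsto (tendsto_G_threshold_nhdsLT hw (sInf S)) ?_
    filter_upwards [self_mem_nhdsWithin] with s hs
    exact (lt_of_not_ge fun h => notMem_of_lt_csInf hs hbdd h).le

end

theorem threshold_eq_bot {s : ℝ} (h : ∀ x : P.State, s < x) :
    P.threshold s = P.threshold ⊥ := by
  have : P.thresholdRule s = P.thresholdRule ⊥ := by
    ext1 x
    rw [thresholdRule_of_lt (EReal.coe_lt_coe_iff.2 (h x)),
      thresholdRule_of_lt (EReal.bot_lt_coe _)]
  simp only [threshold_eq, this]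

theorem threshold_eq_top {t : ℝ} (h : ∀ x : P.State, (x : ℝ) ≤ t) :
    P.threshold t = P.threshold ⊤ := by
  have : P.thresholdRule t = P.thresholdRule ⊤ := by
    ext1 x
    rw [thresholdRule_of_le (EReal.coe_le_coe_iff.2 (h x)), thresholdRule_of_le le_top]
  simp only [threshold_eq, this]

theorem thresholdLeft_eq_top {t : EReal} (h : ∀ x : P.State, ((x : ℝ) : EReal) < t) :
    P.thresholdLeft t = P.threshold ⊤ := by
  have : P.thresholdLeftRule t = P.thresholdRule ⊤ := by
    ext1 x
    rw [thresholdLeftRule_of_lt (h x), thresholdRule_of_le le_top]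
  simp only [threshold_eq, thresholdLeft_eq, this]

/-- The state space is an interval: with a state at most s and another at least t, the midpoint of s
and t is a state. The other two cases lead to the always-active or the never-active policy. -/
theorem exists_state_between_or {s t : ℝ} (hst : s < t) :
    (∃ x : P.State, s < x ∧ (x : ℝ) < t) ∨ (∀ x : P.State, s < x) ∨
      ∀ x : P.State, (x : ℝ) < t := by
  by_contra! ⟨h1, ⟨x, hx⟩, ⟨y, hy⟩⟩
  have h := h1 ⟨(s + t) / 2, x.2.1.trans (EReal.coe_le_coe_iff.2 (by linarith)),
    (EReal.coe_le_coe_iff.2 (by linarith)).trans y.2.2⟩ (by simp only; linarith)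
  simp only at h
  linarith

omit [IsProbabilityMeasure p] in
theorem measure_between_pos (hp : p.support = univ) {s t : ℝ} {x : P.State} (hs : s < x)
    (ht : (x : ℝ) < t) :
    0 < p {x | (s : EReal) < ((x : ℝ) : EReal) ∧ ((x : ℝ) : EReal) ≤ (t : EReal)} := by
  have hx : x ∈ p.support := hp ▸ mem_univ x
  refine (Measure.mem_support_iff_forall x).1 hx _ ?_
  filter_upwards [continuous_subtype_val.continuousAt.eventually (lt_mem_nhds hs),
    continuous_subtype_val.continuousAt.eventually (gt_mem_nhds ht)] with y h1 h2
  exact ⟨EReal.coe_lt_coe_iff.2 h1, EReal.coe_le_coe_iff.2 h2.le⟩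

/-! ### Strict separation of brackets and the derivative -/

section

variable (hP : P.PCLIndexable) (hw : Integrable P.w p) (hp : p.support = univ)

include hP hw hp

theorem lt_G_threshold_of_le_thresholdLeft {γ s t : ℝ}
    (hγ : γ ∈ Ioo (P.G p (P.threshold ⊤)) (P.G p (P.threshold ⊥))) (hst : s < t)
    (h : γ ≤ P.G p (P.thresholdLeft t)) : γ < P.G p (P.threshold s) := by
  rcases P.exists_state_between_or hst with ⟨x, hsx, hxt⟩ | hx | hx
  · have h1 : s < ((x : ℝ) + t) / 2 := by linarith
    have h2 : ((x : ℝ) + t) / 2 < t := by linarith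
    exact h.trans_lt ((G_thresholdLeft_le_threshold hP hw (EReal.coe_lt_coe_iff.2 h2)).trans_lt
      (G_threshold_lt_threshold hP hw (EReal.coe_le_coe_iff.2 h1.le)
        (measure_between_pos hp hsx (by linarith))))
  · rw [threshold_eq_bot hx]; exact hγ.2
  · rw [thresholdLeft_eq_top fun x => EReal.coe_lt_coe_iff.2 (hx x)] at h
    exact absurd h hγ.1.not_ge

theorem G_threshold_lt_of_G_threshold_le {γ s t : ℝ}
    (hγ : γ ∈ Ioo (P.G p (P.threshold ⊤)) (P.G p (P.threshold ⊥))) (hst : s < t)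
    (h : P.G p (P.threshold s) ≤ γ) : P.G p (P.threshold t) < γ := by
  rcases P.exists_state_between_or hst with ⟨x, hsx, hxt⟩ | hx | hx
  · exact (G_threshold_lt_threshold hP hw (EReal.coe_le_coe_iff.2 hst.le)
      (measure_between_pos hp hsx hxt)).trans_le h
  · rw [threshold_eq_bot hx] at h
    exact absurd h hγ.2.not_ge
  · rw [threshold_eq_top fun x => (hx x).le]; exact hγ.1

theorem hasDerivAt_Φ {γ z : ℝ} (hγ : γ ∈ interior (P.resourceRegion p))
    (h1 : P.G p (P.threshold z) ≤ γ) (h2 : γ ≤ P.G p (P.thresholdLeft z)) :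
    HasDerivAt (P.Φ p) (P.mpIndexReal z) γ := by
  have hsub := interior_resourceRegion_subset hP hw
  rw [hasDerivAt_iff_isLittleO, Asymptotics.isLittleO_iff]
  intro ε hε
  obtain ⟨δ, hδ, hm⟩ := Metric.continuous_iff.1 hP.continuous_mpIndexReal z ε hε
  -- Full support puts γ strictly between the resource values at z ± δ/2, so nearby γ' have their
  -- brackets within δ/2 of z.
  have hlo : P.G p (P.threshold ((z + δ / 2 : ℝ) : EReal)) < γ :=
    G_threshold_lt_of_G_threshold_le hP hw hp (hsub hγ) (by linarith) h1
  have hhi : γ < P.G p (P.threshold ((z - δ / 2 : ℝ) : EReal)) :=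
    lt_G_threshold_of_le_thresholdLeft hP hw hp (hsub hγ) (by linarith) h2
  filter_upwards [isOpen_interior.mem_nhds hγ, Ioo_mem_nhds hlo hhi] with γ' hγ' hI
  obtain ⟨z', h1', h2'⟩ := exists_threshold_bracket hP hw (hsub hγ')
  have hz1 : z - δ / 2 < z' := by
    by_contra! hle
    exact (hI.2.trans_le (antitone_G_threshold hP hw (EReal.coe_le_coe_iff.2 hle))).not_ge h1'
  have hz2 : z' ≤ z + δ / 2 := by
    by_contra! hlt
    exact (h2'.trans (G_thresholdLeft_le_threshold hP hw (EReal.coe_lt_coe_iff.2 hlt))).not_gt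
      hI.1
  have hmz := hm z' (by rw [Real.dist_eq, abs_lt]; constructor <;> linarith)
  rw [Real.dist_eq] at hmz
  -- The two supergradient inequalities place the remainder Φ(γ') − Φ(γ) − m*(z)(γ' − γ) between
  -- (m*(z') − m*(z))(γ' − γ) and 0.
  have hup := Φ_le_Φ_add hP hw h1 h2 (interior_subset hγ')
  have hdn := Φ_le_Φ_add hP hw h1' h2' (interior_subset hγ)
  have hprod : |(P.mpIndexReal z' - P.mpIndexReal z) * (γ' - γ)| ≤ ε * |γ' - γ| := by
    rw [abs_mul]
    exact mul_le_mul_of_nonneg_right hmz.le (abs_nonneg _)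
  have h0 : 0 ≤ ε * |γ' - γ| := by positivity
  rw [abs_le] at hprod
  rw [Real.norm_eq_abs, Real.norm_eq_abs, abs_le, smul_eq_mul]
  constructor <;> linarith [hprod.1]

end

theorem mpIndexExt_coe (z : ℝ) : P.mpIndexExt z = (P.mpIndexReal z : EReal) := by
  rw [mpIndexExt, if_neg (EReal.coe_ne_bot z), if_neg (EReal.coe_ne_top z), EReal.toReal_coe]

end Project

end

theorem mainTheorem3 (P : Project) (hP : P.PCLIndexable)
    (p : Measure P.State) [IsProbabilityMeasure p] (hw : Integrable P.w p)
    (hp : p.support = Set.univ) :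
    DifferentiableOn ℝ (P.Φ p) (interior (P.resourceRegion p)) ∧
      ∀ γ ∈ interior (P.resourceRegion p), ∀ z : EReal,
        P.G p (P.threshold z) ≤ γ → γ ≤ P.G p (P.thresholdLeft z) →
          ((deriv (P.Φ p) γ : ℝ) : EReal) = P.mpIndexExt z := by
  have hsub := Project.interior_resourceRegion_subset hP hw
  refine ⟨fun γ hγ => ?_, fun γ hγ z h1 h2 => ?_⟩
  · obtain ⟨z, h1, h2⟩ := Project.exists_threshold_bracket hP hw (hsub hγ)
    exact (Project.hasDerivAt_Φ hP hw hp hγ h1 h2).differentiableAt.differentiableWithinAt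
  · induction z with
    -- Infinite thresholds cannot bracket an interior γ: they attain the extreme resource values,
    -- and the z⁻-policy at ∞ is never active because states are real.
    | bot => exact absurd h1 (hsub hγ).2.not_ge
    | top =>
      rw [Project.thresholdLeft_eq_top fun x => EReal.coe_lt_top _] at h2
      exact absurd h2 (hsub hγ).1.not_ge
    | coe z => rw [(Project.hasDerivAt_Φ hP hw hp hγ h1 h2).deriv, Project.mpIndexExt_coe]
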